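/- Let $\mathcal Y$ be a finite set and $(P_\theta)_{\theta\in\Theta}$ a family of probability measures on $\mathcal Y$ all of whose entries are positive. Let $W$ be a real random variable with $EW=1$, $\operatorname{Var}W=1$, whose cumulant generating function $M(t)=\log E e^{tW}\in(-\infty,+\infty]$ is finite in a neighbourhood of $0$, and put $$\varphi^W(x)=\sup_{t\in\mathbb R}\,(tx-M(t))\in[0,+\infty],\qquad \phi^W(Q,\theta)=\sum_{k\in\mathcal Y}P_\theta(k)\,\varphi^W\!\left(\frac{Q(k)}{P_\theta(k)}\right)\ \ (Q\in\mathbb R^{\mathcal Y}),\qquad \phi^W(A,\theta)=\inf_{Q\in A}\phi^W(Q,\theta),$$ with $\inf\emptyset=+\infty$. For $r\in\mathbb R$ and $R\in\mathbb R^{\mathcal Y}$ let $V_r(R)$ be the set of probability vectors $Q$ on $\mathcal Y$ with $\max_k|Q(k)-R(k)|\le r$. Let $\theta_T,\theta\in\Theta$. Let $X_1,X_2,\dots$ (observed) be iid with law $P_{\theta_T}$, let $X_{1,\theta},X_{2,\theta},\dots$ (simulated) be iid with law $P_\theta$, and let $W_1,W_2,\dots$ be iid copies of $W$, independent of the two samples.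 Put $$P_n=\frac1n\sum_{i=1}^n\delta_{X_i},\qquad \mathfrak P^W_{n,\theta}=\sum_{i=1}^n\frac{W_i}{\sum_{j=1}^nW_j}\,\delta_{X_{i,\theta}}$$ (all values of $\mathfrak P^W_{n,\theta}$ are $+\infty$ if $\sum_jW_j=0$), and for $\varepsilon>0$ let $$L_n=\frac1n\log P\left(\mathfrak P^W_{n,\theta}\in V_\varepsilon(P_n)\,\middle|\,X_{1,\theta},\dots,X_{n,\theta},X_1,\dots,X_n\right),\qquad \log 0=-\infty .$$ Then for every $\varepsilon>0$, almost surely, for all real $\alpha<1<\beta$, $$-\inf_{m\ne0}\phi^W\big(mV_{\alpha\varepsilon}(P_{\theta_T}),\theta\big)\ \le\ \liminf_{n\to\infty}L_n\ \le\ \limsup_{n\to\infty}L_n\ \le\ -\inf_{m\ne0}\phi^W\big(mV_{\beta\varepsilon}(P_{\theta_T}),\theta\big).$$ Moreover, if $\varepsilon\neq\varepsilon^*:=\inf\{r\in\mathbb R:\inf_{m\neq0}\phi^W(mV_r(P_{\theta_T}),\theta)<+\infty\}$, then almost surely $\lim_{n\to\infty}L_n$ exists in $[-\infty,0]$, and for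 all real $\alpha<1<\beta$ $$-\inf_{m\ne0}\phi^W\big(mV_{\alpha\varepsilon}(P_{\theta_T}),\theta\big)\ \le\ \lim_{n\to\infty}L_n\ \le\ -\inf_{m\ne0}\phi^W\big(mV_{\beta\varepsilon}(P_{\theta_T}),\theta\big).$$ -/

import Mathlib

open MeasureTheory ProbabilityTheory Filter Topology
open scoped Pointwise ENNReal

noncomputable section

namespace WeightedBootstrap

/-- The cumulant generating function `M(t) = log E exp(tW)` of a law `ν` on the real line, with
value `⊤` where the expectation is infinite. -/
def cumulant (ν : Measure ℝ) (t : ℝ) : EReal :=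
  ENNReal.log (∫⁻ w, ENNReal.ofReal (Real.exp (t * w)) ∂ν)

/-- The divergence function `φ^W(x) = sup_t (t x - M(t))`, with values in `[0, ⊤]`. -/
def phiW (ν : Measure ℝ) (x : ℝ) : EReal :=
  ⨆ t : ℝ, ((t * x : ℝ) : EReal) - cumulant ν t

/-- The standing assumptions on the law of the weights: the cumulant generating function is finite
in a neighbourhood of `0`, the mean is `1` and the variance is `1`. -/
structure IsWeightLaw (ν : Measure ℝ) : Prop where
  isProbabilityMeasure : IsProbabilityMeasure ν
  cumulant_finite : ∀ᶠ t in 𝓝 (0 : ℝ), cumulant ν t < ⊤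
  mean_eq_one : ∫ w, w ∂ν = 1
  variance_eq_one : variance id ν = 1

variable {Y Ω : Type*}

/-- The divergence `φ^W(Q, P) = ∑ k, p_k φ^W(q_k / p_k)` between a finite signed measure `Q` and a
probability measure `P` with positive entries on the finite set `Y`. -/
def divW [Fintype Y] (ν : Measure ℝ) (Q P : Y → ℝ) : EReal :=
  ∑ k, (P k : EReal) * phiW ν (Q k / P k)

/-- `φ^W(A, P) = inf_{Q ∈ A} φ^W(Q, P)`, equal to `⊤` when `A` is empty. -/
def divWSet [Fintype Y] (ν : Measure ℝ) (A : Set (Y → ℝ)) (P : Y → ℝ) : EReal :=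
  ⨅ Q ∈ A, divW ν Q P

/-- `inf_{m ≠ 0} φ^W(m A, P)`. -/
def coneDivW [Fintype Y] (ν : Measure ℝ) (A : Set (Y → ℝ)) (P : Y → ℝ) : EReal :=
  ⨅ (m : ℝ) (_ : m ≠ 0), divWSet ν (m • A) P

/-- `V_r(R)`: the probability vectors `Q` with `max_k |Q(k) - R(k)| ≤ r`. -/
def nbhd [Fintype Y] (r : ℝ) (R : Y → ℝ) : Set (Y → ℝ) :=
  {Q | Q ∈ stdSimplex ℝ Y ∧ ∀ k, |Q k - R k| ≤ r}

/-- The mass that the Dirac measure at `y` gives to the point `k`. -/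
def diracAt (y k : Y) : ℝ := ({y} : Set Y).indicator (fun _ => 1) k

/-- The empirical measure `(1/n) ∑_{i<n} δ_{x_i}`. -/
def empirical (x : ℕ → Y) (n : ℕ) (k : Y) : ℝ :=
  (1 / (n : ℝ)) * ∑ i ∈ Finset.range n, diracAt (x i) k

open Classical in
/-- The normalized weighted empirical measure `∑_{i<n} (w_i / ∑_j w_j) δ_{x_i}`; all its values are
`⊤` when the sum of the weights is `0`. -/
def normWeighted (x : ℕ → Y) (w : ℕ → ℝ) (n : ℕ) (k : Y) : EReal :=
  if ∑ j ∈ Finset.range n, w j = 0 then ⊤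
  else ((∑ i ∈ Finset.range n, (w i / ∑ j ∈ Finset.range n, w j) * diracAt (x i) k : ℝ) : EReal)

/-- The event that the normalized weighted empirical measure of the simulated sample `S` lies in the
`ε`-neighbourhood of the empirical measure of the observed sample `X`, both of size `n`. -/
def closeEvent [Fintype Y] (X S : ℕ → Ω → Y) (W : ℕ → Ω → ℝ) (ε : ℝ) (n : ℕ) : Set Ω :=
  {ω | ∃ Q ∈ nbhd ε (empirical (fun i => X i ω) n),
    normWeighted (fun i => S i ω) (fun i => W i ω) n = fun k => (Q k : EReal)}

/-- The event that both samples of size `n` take the values that they take at `ω`. -/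
def sampleEvent (X S : ℕ → Ω → Y) (n : ℕ) (ω : Ω) : Set Ω :=
  {ω' | ∀ i < n, S i ω' = S i ω ∧ X i ω' = X i ω}

/-- `(1/n) log P(closeEvent | S_1, …, S_n, X_1, …, X_n)`, as a function of the outcome `ω`. The samples
are discrete, so this is the elementary conditional probability given their values at `ω`;
`log 0 = ⊥`. -/
def logCondProb [Fintype Y] [MeasurableSpace Ω] (μ : Measure Ω) (X S : ℕ → Ω → Y)
    (W : ℕ → Ω → ℝ) (ε : ℝ) (n : ℕ) (ω : Ω) : EReal :=
  ((1 / (n : ℝ) : ℝ) : EReal) *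
    ENNReal.log (ProbabilityTheory.cond μ (sampleEvent X S n ω) (closeEvent X S W ε n))

/-- The smallest radius from which on the rate `inf_{m ≠ 0} φ^W(m V_r(R), P)` is finite. For
probability vectors `R` and `P`, the set is bounded below by `0` and contains `1`. -/
def criticalRadius [Fintype Y] (ν : Measure ℝ) (R P : Y → ℝ) : ℝ :=
  sInf {r : ℝ | coneDivW ν (nbhd r R) P < ⊤}

end WeightedBootstrap

end

namespace WeightedBootstrap

/-! The weights are independent of the samples, so conditioning freezes the samples
(`cond_closeEvent`), and the event says that the unnormalized vector `blockMean` lies in the cone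
over `V_ε(P_n)`. By the strong law both empirical measures almost surely converge, and what remains
is a large deviation problem for weighted sums along one deterministic sequence of points, with rate
`divW`.

Upper bound (`hasDecay_of_isClosed`): Chernoff's inequality gives decay on half-spaces, compactness
and exponential tightness give it on closed sets. The cone over a slightly larger neighbourhood is
closed once its apex is added, and the apex does not lower the infimum (`coneDivW_le_divW_zero`).

Lower bound (`eventually_le_measure_blockMean`): tilt the law of each weight so that its mean is the
desired ratio, and use Chebyshev's inequality under the tilted law. The Laplace transform may be
infinite away from `0`, so the tilts come from truncations (`exists_tilt`). They need ratios
interior to the convex hull of the support; `exists_interior_point` arranges this at arbitrarily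
small cost.

Limit: below the critical radius the upper bound is already `⊥`. Above it, a near-minimizer at a
radius just above `ε` is mixed with a point of smaller radius and finite divergence. By convexity
this costs little and brings the radius below `ε` (`exists_coneDivW_le_of_forall_le`), so the two
bounds leave no gap. Masses of both signs occur; only points of equal sign may be mixed, since
otherwise the total mass could cancel. -/

/-! ### The cumulant generating function and its conjugate. -/

lemma lintegral_exp_ne_zero {ν : Measure ℝ} [IsProbabilityMeasure ν] (t : ℝ) :
    ∫⁻ w, ENNReal.ofReal (Real.exp (t * w)) ∂ν ≠ 0 := by
  intro h
  rw [lintegral_eq_zero_iff (by fun_prop)] at h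
  have : ∀ᵐ w ∂ν, False := by
    filter_upwards [h] with w hw
    simp only [Pi.zero_apply, ENNReal.ofReal_eq_zero] at hw
    exact absurd (Real.exp_pos (t * w)) (not_lt.2 hw)
  simp at this
  exact IsProbabilityMeasure.ne_zero ν this

lemma cumulant_ne_bot {ν : Measure ℝ} [IsProbabilityMeasure ν] (t : ℝ) : cumulant ν t ≠ ⊥ := by
  simpa [cumulant] using lintegral_exp_ne_zero t

lemma cumulant_eq_coe_iff {ν : Measure ℝ} {t l : ℝ} :
    cumulant ν t = l ↔ ∫⁻ w, ENNReal.ofReal (Real.exp (t * w)) ∂ν = ENNReal.ofReal (Real.exp l) := by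
  rw [cumulant, ← ENNReal.log_eq_iff, ENNReal.log_ofReal_of_pos (Real.exp_pos l), Real.log_exp]

lemma cumulant_zero {ν : Measure ℝ} [IsProbabilityMeasure ν] : cumulant ν 0 = (0 : ℝ) := by
  simp [cumulant]

lemma exists_cumulant_eq {ν : Measure ℝ} [IsProbabilityMeasure ν] {t : ℝ} (h : cumulant ν t < ⊤) :
    ∃ l : ℝ, cumulant ν t = l :=
  ⟨_, (EReal.coe_toReal h.ne (cumulant_ne_bot t)).symm⟩

lemma le_phiW (ν : Measure ℝ) {x t l : ℝ} (h : cumulant ν t = l) :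
    ((t * x - l : ℝ) : EReal) ≤ phiW ν x := by
  refine le_trans (le_of_eq ?_) (le_iSup _ t)
  rw [h, EReal.coe_sub]

/-- Exponents with infinite cumulant contribute `⊥` to the supremum, so only real cumulants matter
and arguments about `phiW` become real arithmetic. -/
lemma lt_phiW_iff {ν : Measure ℝ} [IsProbabilityMeasure ν] {x a : ℝ} :
    (a : EReal) < phiW ν x ↔ ∃ t l : ℝ, cumulant ν t = l ∧ a < t * x - l := by
  constructor
  · intro h
    obtain ⟨t, ht⟩ := lt_iSup_iff.1 h
    have hfin : cumulant ν t < ⊤ := by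
      by_contra hc
      rw [not_lt_top_iff.1 hc, EReal.sub_top] at ht
      exact not_lt_bot ht
    obtain ⟨l, hl⟩ := exists_cumulant_eq hfin
    refine ⟨t, l, hl, ?_⟩
    rw [hl, ← EReal.coe_sub] at ht
    exact_mod_cast ht
  · rintro ⟨t, l, hl, hlt⟩
    exact lt_of_lt_of_le (by exact_mod_cast hlt) (le_phiW ν hl)

lemma phiW_le_iff {ν : Measure ℝ} [IsProbabilityMeasure ν] {x a : ℝ} :
    phiW ν x ≤ a ↔ ∀ t l : ℝ, cumulant ν t = l → t * x - l ≤ a := by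
  rw [← not_lt, lt_phiW_iff]
  push Not
  rfl

lemma phiW_nonneg {ν : Measure ℝ} [IsProbabilityMeasure ν] (x : ℝ) : 0 ≤ phiW ν x := by
  simpa using le_phiW ν (x := x) (cumulant_zero (ν := ν))

lemma exists_phiW_eq {ν : Measure ℝ} [IsProbabilityMeasure ν] {x : ℝ} (h : phiW ν x < ⊤) :
    ∃ a : ℝ, phiW ν x = a :=
  ⟨_, (EReal.coe_toReal h.ne (lt_of_lt_of_le EReal.bot_lt_zero (phiW_nonneg x)).ne').symm⟩

lemma phiW_convex {ν : Measure ℝ} [IsProbabilityMeasure ν] {x y a b r : ℝ} (hx : phiW ν x ≤ a)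
    (hy : phiW ν y ≤ b) (h0 : 0 ≤ r) (h1 : r ≤ 1) :
    phiW ν ((1 - r) * x + r * y) ≤ ((1 - r) * a + r * b : ℝ) := by
  rw [phiW_le_iff] at *
  intro t l hl
  nlinarith [mul_le_mul_of_nonneg_left (hx t l hl) (sub_nonneg.2 h1),
    mul_le_mul_of_nonneg_left (hy t l hl) h0]

lemma integrable_of_mean_eq_one {ν : Measure ℝ} (h : ∫ w, w ∂ν = 1) :
    Integrable (fun w : ℝ => w) ν := by
  by_contra hc
  rw [integral_undef hc] at h
  exact zero_ne_one h

/-- Jensen's inequality, obtained by integrating the tangent line of the exponential at the mean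
`1`. -/
lemma le_cumulant {ν : Measure ℝ} (hν : IsWeightLaw ν) {t l : ℝ} (h : cumulant ν t = l) : t ≤ l := by
  have := hν.isProbabilityMeasure
  have hi := integrable_of_mean_eq_one hν.mean_eq_one
  have hi' : Integrable (fun w => t * (w - 1)) ν := (hi.sub (integrable_const 1)).const_mul t
  rw [cumulant_eq_coe_iff] at h
  have hexp : Integrable (fun w => Real.exp (t * w)) ν := by
    refine ⟨by fun_prop, ?_⟩
    rw [hasFiniteIntegral_iff_ofReal (ae_of_all _ fun w => (Real.exp_pos _).le), h]
    exact ENNReal.ofReal_lt_top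
  have h2 : ∫ w, Real.exp (t * w) ∂ν = Real.exp l := by
    rw [integral_eq_lintegral_of_nonneg_ae (ae_of_all _ fun w => (Real.exp_pos _).le) (by fun_prop),
      h, ENNReal.toReal_ofReal (Real.exp_pos l).le]
  have h3 : ∫ w, Real.exp t * (1 + t * (w - 1)) ∂ν = Real.exp t := by
    rw [integral_const_mul, integral_add (integrable_const _) hi',
      integral_const_mul, integral_sub hi (integrable_const _)]
    simp [hν.mean_eq_one]
  have h4 : Real.exp t ≤ Real.exp l := by
    rw [← h2, ← h3]
    refine integral_mono (((integrable_const 1).add hi').const_mul _) hexp fun w => ?_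
    have : Real.exp (t * w) = Real.exp t * Real.exp (t * (w - 1)) := by
      rw [← Real.exp_add]; ring_nf
    simp only [this]
    gcongr
    linarith [Real.add_one_le_exp (t * (w - 1))]
  exact Real.exp_le_exp.1 h4

lemma phiW_one {ν : Measure ℝ} (hν : IsWeightLaw ν) : phiW ν 1 = 0 := by
  have := hν.isProbabilityMeasure
  refine le_antisymm ?_ (phiW_nonneg 1)
  have : phiW ν 1 ≤ ((0 : ℝ) : EReal) := phiW_le_iff.2 fun t l hl => by
    linarith [le_cumulant hν hl]
  simpa using this

/-- Left of the mean only `t ≤ 0` matters: for `t ≥ 0` Jensen's inequality makes the term at `y`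
nonpositive. -/
lemma phiW_antitone {ν : Measure ℝ} (hν : IsWeightLaw ν) {x y : ℝ} (hxy : x ≤ y) (hy : y ≤ 1) :
    phiW ν y ≤ phiW ν x := by
  have := hν.isProbabilityMeasure
  refine EReal.le_of_forall_lt_iff_le.1 fun z hz => ?_
  refine phiW_le_iff.2 fun t l hl => ?_
  have h0 : 0 ≤ z := by exact_mod_cast (phiW_nonneg x).trans hz.le
  have hx := phiW_le_iff.1 hz.le t l hl
  rcases le_total t 0 with ht | ht
  · nlinarith
  · nlinarith [le_cumulant hν hl]

lemma exists_pos_cumulant {ν : Measure ℝ} (hν : IsWeightLaw ν) :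
    ∃ t C : ℝ, 0 < t ∧ (∃ l : ℝ, cumulant ν t = l ∧ l ≤ C) ∧ (∃ l : ℝ, cumulant ν (-t) = l ∧ l ≤ C) := by
  have := hν.isProbabilityMeasure
  obtain ⟨r, hr, h⟩ := Metric.eventually_nhds_iff.1 hν.cumulant_finite
  obtain ⟨l, hl⟩ := exists_cumulant_eq (h (y := r / 2) (by simp [abs_of_pos hr]; linarith))
  obtain ⟨l', hl'⟩ := exists_cumulant_eq (h (y := -(r / 2)) (by simp [abs_of_pos hr]; linarith))
  exact ⟨r / 2, max l l', by positivity, ⟨l, hl, le_max_left _ _⟩, ⟨l', hl', le_max_right _ _⟩⟩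

/-- The divergence function grows at least linearly. -/
lemma exists_phiW_coercive {ν : Measure ℝ} (hν : IsWeightLaw ν) :
    ∃ t C : ℝ, 0 < t ∧ ∀ x a : ℝ, phiW ν x ≤ a → t * |x| - C ≤ a := by
  have := hν.isProbabilityMeasure
  obtain ⟨t, C, ht, ⟨l, hl, hlC⟩, ⟨l', hl', hlC'⟩⟩ := exists_pos_cumulant hν
  refine ⟨t, C, ht, fun x a h => ?_⟩
  rw [phiW_le_iff] at h
  rcases abs_cases x with ⟨hx, _⟩ | ⟨hx, _⟩ <;> rw [hx]
  · linarith [h t l hl]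
  · linarith [h _ l' hl']

lemma lintegral_exp_sub {ν : Measure ℝ} (t x : ℝ) :
    ∫⁻ w, ENNReal.ofReal (Real.exp (t * (w - x))) ∂ν =
      ENNReal.ofReal (Real.exp (-(t * x))) * ∫⁻ w, ENNReal.ofReal (Real.exp (t * w)) ∂ν := by
  rw [← lintegral_const_mul _ (by fun_prop)]
  congr 1 with w
  rw [← ENNReal.ofReal_mul (Real.exp_pos _).le, ← Real.exp_add]
  ring_nf

/-- Exponentiating the conjugate turns it into a lower bound for the Laplace transform of `w - x`,
in which infinite values need no separate treatment. -/
lemma phiW_le_iff_lintegral {ν : Measure ℝ} [IsProbabilityMeasure ν] {x a : ℝ} :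
    phiW ν x ≤ a ↔ ∀ t : ℝ, ENNReal.ofReal (Real.exp (-a)) ≤
      ∫⁻ w, ENNReal.ofReal (Real.exp (t * (w - x))) ∂ν := by
  rw [phiW_le_iff]
  refine forall_congr' fun t => ?_
  rw [lintegral_exp_sub]
  by_cases hfin : cumulant ν t < ⊤
  · obtain ⟨l, hl⟩ := exists_cumulant_eq hfin
    rw [cumulant_eq_coe_iff.1 hl, ← ENNReal.ofReal_mul (Real.exp_pos _).le, ← Real.exp_add,
      ENNReal.ofReal_le_ofReal_iff (Real.exp_pos _).le, Real.exp_le_exp]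
    constructor
    · intro h; linarith [h l hl]
    · intro h l' hl'
      have : l' = l := by exact_mod_cast hl'.symm.trans hl
      linarith
  · have htop : ∫⁻ w, ENNReal.ofReal (Real.exp (t * w)) ∂ν = ⊤ := by
      simpa [cumulant] using hfin
    rw [htop, ENNReal.mul_top (by simp [Real.exp_pos])]
    have : cumulant ν t = ⊤ := by simpa using hfin
    simp [this]

/-- A point of finite divergence lies in the closed convex hull of the support. -/
lemma measure_half_line_ne_zero {ν : Measure ℝ} [IsProbabilityMeasure ν] {x a : ℝ}
    (h : phiW ν x ≤ a) (s : ℝ) : ν {w | 0 ≤ s * (w - x)} ≠ 0 := by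
  intro h0
  rw [phiW_le_iff_lintegral] at h
  have hneg : ∀ᵐ w ∂ν, s * (w - x) < 0 := by
    rw [ae_iff]; simpa using h0
  -- If `s (w - x) < 0` almost everywhere, the Laplace transform tends to `0` along `t = n s`,
  -- against its positive lower bound.
  have hlim : Tendsto (fun n : ℕ => ∫⁻ w, ENNReal.ofReal (Real.exp (n * s * (w - x))) ∂ν) atTop
      (𝓝 (∫⁻ _, 0 ∂ν)) := by
    refine tendsto_lintegral_of_dominated_convergence (fun _ => 1) (fun n => by fun_prop) ?_
      (by simp) ?_
    · intro n
      filter_upwards [hneg] with w hw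
      rw [ENNReal.ofReal_le_one, Real.exp_le_one_iff, mul_assoc]
      exact mul_nonpos_of_nonneg_of_nonpos n.cast_nonneg hw.le
    · filter_upwards [hneg] with w hw
      rw [← ENNReal.ofReal_zero]
      refine ENNReal.tendsto_ofReal (Real.tendsto_exp_atBot.comp ?_)
      simp_rw [mul_assoc]
      exact tendsto_natCast_atTop_atTop.atTop_mul_const_of_neg hw
  have := ge_of_tendsto' hlim fun n => h (n * s)
  simp only [lintegral_zero, nonpos_iff_eq_zero, ENNReal.ofReal_eq_zero] at this
  exact absurd (Real.exp_pos (-a)) (not_lt.2 this)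

/-- The weights exceed their mean and stay below it with positive probability. -/
lemma measure_mean_half_line_ne_zero {ν : Measure ℝ} (hν : IsWeightLaw ν) {s : ℝ} (hs : s ≠ 0) :
    ν {w | 0 < s * (w - 1)} ≠ 0 := by
  have := hν.isProbabilityMeasure
  intro h0
  have hi := integrable_of_mean_eq_one hν.mean_eq_one
  -- A nonnegative function with integral zero vanishes almost everywhere; then `w = 1` almost
  -- surely, against unit variance.
  have hneg : ∀ᵐ w ∂ν, 0 ≤ -(s * (w - 1)) := by
    rw [ae_iff]; simpa using h0
  have hint : ∫ w, -(s * (w - 1)) ∂ν = 0 := by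
    rw [integral_neg, integral_const_mul, integral_sub hi (integrable_const _)]
    simp [hν.mean_eq_one]
  have hz := (integral_eq_zero_iff_of_nonneg_ae hneg
    ((hi.sub (integrable_const 1)).const_mul s).neg).1 hint
  have hone : (id : ℝ → ℝ) =ᵐ[ν] fun _ => 1 := by
    filter_upwards [hz] with w hw
    have : w - 1 = 0 := by simpa [hs] using hw
    simp only [id]; linarith
  have := hν.variance_eq_one
  rw [variance_congr hone] at this
  simp [variance_eq_integral] at this

/-- Moving a point of finite divergence towards the mean leads into the interior of the convex hull
of the support. -/
lemma measure_ne_zero_of_phiW_le {ν : Measure ℝ} (hν : IsWeightLaw ν) {y z a r : ℝ}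
    (hy : phiW ν y ≤ a) (h0 : 0 < r) (h1 : r < 1) (s : ℝ)
    (hzi : ν {w | 0 < s * (w - z)} ≠ 0) :
    ν {w | 0 < s * (w - ((1 - r) * y + r * z))} ≠ 0 := by
  have := hν.isProbabilityMeasure
  -- If `z` lies at least as far as `y` in direction `s`, the open half-line at `z` lies in the one
  -- at the mixture; otherwise the closed half-line at `y` lies strictly beyond the mixture.
  rcases le_total (s * y) (s * z) with h | h
  · refine fun hc => hzi (measure_mono_null (fun w hw => ?_) hc)
    simp only [Set.mem_ofPred_eq] at hw ⊢
    nlinarith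
  · rcases h.eq_or_lt with h | h
    · refine fun hc => hzi (measure_mono_null (fun w hw => ?_) hc)
      simp only [Set.mem_ofPred_eq] at hw ⊢
      nlinarith
    · refine fun hc => measure_half_line_ne_zero hy s (measure_mono_null (fun w hw => ?_) hc)
      simp only [Set.mem_ofPred_eq] at hw ⊢
      nlinarith

/-! ### Truncated Laplace transforms and exponential tilting. -/

lemma exists_measure_slab_ne_zero {ν : Measure ℝ} {x s : ℝ} (h : ν {w | 0 < s * (w - x)} ≠ 0) :
    ∃ n : ℕ, ν {w | 1 / ((n : ℝ) + 1) ≤ s * (w - x) ∧ |w - x| ≤ n} ≠ 0 := by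
  by_contra hc
  push Not at hc
  refine h (measure_mono_null (fun w hw => ?_) (measure_iUnion_null hc))
  obtain ⟨n, hn⟩ := exists_nat_one_div_lt (show 0 < s * (w - x) from hw)
  obtain ⟨m, hm⟩ := exists_nat_ge |w - x|
  refine Set.mem_iUnion.2 ⟨max n m, le_trans ?_ hn.le, hm.trans (by simp)⟩
  refine one_div_le_one_div_of_le (by positivity) ?_
  gcongr
  simp

/-- The truncated Laplace transform of `w - x`. -/
noncomputable def truncMgf (ν : Measure ℝ) (x : ℝ) (n : ℕ) (t : ℝ) : ℝ :=
  ∫ w in Set.Icc (x - n) (x + n), Real.exp (t * (w - x)) ∂ν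

lemma ae_restrict_mem_Icc (ν : Measure ℝ) (x : ℝ) (n : ℕ) :
    ∀ᵐ w ∂ν.restrict (Set.Icc (x - n) (x + n)), w - x ∈ Set.Icc (-(n : ℝ)) n := by
  filter_upwards [ae_restrict_mem measurableSet_Icc] with w hw
  constructor <;> linarith [hw.1, hw.2]

section truncMgf

variable {ν : Measure ℝ} [IsProbabilityMeasure ν] {x : ℝ}

lemma integrable_trunc (n : ℕ) (t : ℝ) :
    Integrable (fun w => Real.exp (t * (w - x))) (ν.restrict (Set.Icc (x - n) (x + n))) :=
  integrable_exp_mul_of_mem_Icc (by fun_prop) (ae_restrict_mem_Icc ν x n)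

lemma hasDerivAt_truncMgf (n : ℕ) (t : ℝ) :
    HasDerivAt (truncMgf ν x n)
      (∫ w in Set.Icc (x - n) (x + n), (w - x) * Real.exp (t * (w - x)) ∂ν) t := by
  have huniv : integrableExpSet (fun w => w - x) (ν.restrict (Set.Icc (x - n) (x + n))) =
      Set.univ := Set.eq_univ_of_forall fun t => integrable_trunc n t
  exact hasDerivAt_mgf (X := fun w => w - x) (μ := ν.restrict (Set.Icc (x - n) (x + n)))
    (by simp [huniv])

lemma continuous_truncMgf (n : ℕ) : Continuous (truncMgf ν x n) :=
  continuous_iff_continuousAt.2 fun t => (hasDerivAt_truncMgf n t).continuousAt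

lemma truncMgf_mono (t : ℝ) : Monotone fun n => truncMgf ν x n t := by
  intro m n hmn
  refine setIntegral_mono_set (integrable_trunc n t) (ae_of_all _ fun w => (Real.exp_pos _).le)
    (Set.Icc_subset_Icc ?_ ?_).eventuallyLE <;> gcongr

lemma ofReal_truncMgf (n : ℕ) (t : ℝ) : ENNReal.ofReal (truncMgf ν x n t) =
    ∫⁻ w in Set.Icc (x - n) (x + n), ENNReal.ofReal (Real.exp (t * (w - x))) ∂ν :=
  ofReal_integral_eq_lintegral_ofReal (integrable_trunc n t) (ae_of_all _ fun _ => (Real.exp_pos _).le)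

/-- A bounded slab where `s (w - x) ≥ c` has positive mass `d`; every truncation containing it
inherits its exponential growth. -/
lemma exists_le_truncMgf_of_sign {s : ℝ} (h : ν {w | 0 < s * (w - x)} ≠ 0) :
    ∃ (n : ℕ) (c d : ℝ), 0 < c ∧ 0 < d ∧ ∀ m ≥ n, ∀ r ≥ 0,
      d * Real.exp (c * r) ≤ truncMgf ν x m (r * s) := by
  obtain ⟨n, hn⟩ := exists_measure_slab_ne_zero h
  set A := {w | 1 / ((n : ℝ) + 1) ≤ s * (w - x) ∧ |w - x| ≤ n} with hA
  have hAm : MeasurableSet A := by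
    rw [hA, Set.ofPred_and]
    exact (measurableSet_le (by fun_prop) (by fun_prop)).inter
      (measurableSet_le (by fun_prop) (by fun_prop))
  refine ⟨n, 1 / ((n : ℝ) + 1), ν.real A, by positivity,
    ENNReal.toReal_pos hn (measure_ne_top _ _), fun m hm r hr => ?_⟩
  have hsub : A ⊆ Set.Icc (x - m) (x + m) := fun w hw => by
    have := abs_le.1 hw.2
    have hm' : (n : ℝ) ≤ m := by exact_mod_cast hm
    constructor <;> linarith
  calc ν.real A * Real.exp (1 / ((n : ℝ) + 1) * r)
      = ∫ w in A, Real.exp (1 / ((n : ℝ) + 1) * r) ∂ν := by simp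
    _ ≤ ∫ w in A, Real.exp (r * s * (w - x)) ∂ν := by
        refine setIntegral_mono_on (integrable_const _)
          ((integrable_trunc m (r * s)).mono_measure (Measure.restrict_mono hsub le_rfl)) hAm ?_
        intro w hw
        rw [Real.exp_le_exp, mul_comm, mul_assoc]
        exact mul_le_mul_of_nonneg_left hw.1 hr
    _ ≤ truncMgf ν x m (r * s) := setIntegral_mono_set (integrable_trunc m _)
        (ae_of_all _ fun w => (Real.exp_pos _).le) hsub.eventuallyLE

/-- The slope `b` does not depend on the truncation level. This gives minimizers and confines the
sublevel sets of all far truncations to one compact set. -/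
lemma exists_le_truncMgf (h1 : ν {w | 0 < 1 * (w - x)} ≠ 0) (h2 : ν {w | 0 < (-1) * (w - x)} ≠ 0) :
    ∃ (n : ℕ) (b : ℝ), 0 < b ∧ ∀ m ≥ n, ∀ t, b * |t| ≤ truncMgf ν x m t := by
  obtain ⟨n, c, d, hc, hd, h⟩ := exists_le_truncMgf_of_sign h1
  obtain ⟨n', c', d', hc', hd', h'⟩ := exists_le_truncMgf_of_sign h2
  refine ⟨max n n', min (d * c) (d' * c'), lt_min (mul_pos hd hc) (mul_pos hd' hc'),
    fun m hm t => ?_⟩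
  rcases abs_cases t with ⟨ht, h0⟩ | ⟨ht, h0⟩
  · have := h m ((le_max_left _ _).trans hm) t h0
    rw [mul_one] at this
    calc _ ≤ d * c * |t| := by gcongr; exact min_le_left _ _
      _ = d * (c * t) := by rw [ht]; ring
      _ ≤ d * Real.exp (c * t) := by gcongr; linarith [Real.add_one_le_exp (c * t)]
      _ ≤ _ := this
  · have := h' m ((le_max_right _ _).trans hm) (-t) (by linarith)
    rw [mul_neg_one, neg_neg] at this
    calc _ ≤ d' * c' * |t| := by gcongr; exact min_le_right _ _
      _ = d' * (c' * -t) := by rw [ht]; ring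
      _ ≤ d' * Real.exp (c' * -t) := by gcongr; linarith [Real.add_one_le_exp (c' * -t)]
      _ ≤ _ := this

lemma lintegral_le_of_truncMgf_le {t b : ℝ} (n : ℕ) (h : ∀ m ≥ n, truncMgf ν x m t ≤ b) :
    ∫⁻ w, ENNReal.ofReal (Real.exp (t * (w - x))) ∂ν ≤ ENNReal.ofReal b := by
  have hmono : Monotone fun m : ℕ => Set.Icc (x - m) (x + m) := fun i j hij =>
    Set.Icc_subset_Icc (by gcongr) (by gcongr)
  have hU : ⋃ m : ℕ, Set.Icc (x - m) (x + m) = Set.univ := by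
    refine Set.eq_univ_of_forall fun w => ?_
    obtain ⟨m, hm⟩ := exists_nat_ge |w - x|
    have := abs_le.1 hm
    exact Set.mem_iUnion.2 ⟨m, by linarith, by linarith⟩
  rw [← setLIntegral_univ, ← hU, setLIntegral_iUnion_of_directed _ hmono.directed_le]
  refine iSup_le fun m => ?_
  rw [← ofReal_truncMgf]
  exact ENNReal.ofReal_le_ofReal
    ((truncMgf_mono t (le_max_left m n)).trans (h _ (le_max_right m n)))

/-- Far enough truncations have a minimizer at which the truncated Laplace transform is almost as
large as the divergence function allows. -/
lemma exists_truncMgf_minimizer {a η : ℝ} (hφ : phiW ν x ≤ a)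
    (h1 : ν {w | 0 < 1 * (w - x)} ≠ 0) (h2 : ν {w | 0 < (-1) * (w - x)} ≠ 0) (hη : 0 < η) :
    ∃ (n : ℕ) (t : ℝ), Real.exp (-(a + η)) < truncMgf ν x n t ∧
      ∫ w in Set.Icc (x - n) (x + n), (w - x) * Real.exp (t * (w - x)) ∂ν = 0 := by
  obtain ⟨n, b, hb, h⟩ := exists_le_truncMgf h1 h2
  have hmin : ∀ m ≥ n, ∃ t, ∀ u, truncMgf ν x m t ≤ truncMgf ν x m u := fun m hm =>
    (continuous_truncMgf m).exists_forall_le (tendsto_atTop_mono (h m hm)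
      (tendsto_norm_cocompact_atTop.const_mul_atTop hb))
  by_contra hc
  push Not at hc
  -- The derivative vanishes at a minimizer, so under the contrary assumption every far truncation
  -- has a small minimum.
  have hne : ∀ m ≥ n, ∃ t, truncMgf ν x m t ≤ Real.exp (-(a + η)) := fun m hm => by
    obtain ⟨t, ht⟩ := hmin m hm
    refine ⟨t, not_lt.1 fun hlt => hc m t hlt ?_⟩
    exact IsLocalMin.hasDerivAt_eq_zero (Filter.Eventually.of_forall ht) (hasDerivAt_truncMgf m t)
  have hcl : ∀ i, IsClosed {t | truncMgf ν x (n + i) t ≤ Real.exp (-(a + η))} := fun i =>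
    isClosed_le (continuous_truncMgf _) continuous_const
  -- The sublevel sets are compact and decrease with the truncation level. By monotone convergence,
  -- the full Laplace transform is at most `exp (-(a + η))` at a common point, which contradicts
  -- `φ^W(x) ≤ a`.
  obtain ⟨t, ht⟩ := IsCompact.nonempty_iInter_of_sequence_nonempty_isCompact_isClosed
    (fun i => {t | truncMgf ν x (n + i) t ≤ Real.exp (-(a + η))})
    (fun i t ht => (truncMgf_mono t (by lia : n + i ≤ n + (i + 1))).trans ht)
    (fun i => hne (n + i) (by lia))
    ((isCompact_closedBall (0 : ℝ) (Real.exp (-(a + η)) / b)).of_isClosed_subset (hcl 0)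
      fun t ht => by
        rw [mem_closedBall_zero_iff, Real.norm_eq_abs, le_div_iff₀ hb, mul_comm]
        exact (h _ (by simp) t).trans ht)
    hcl
  rw [Set.mem_iInter] at ht
  have hle := lintegral_le_of_truncMgf_le n (t := t) (b := Real.exp (-(a + η))) fun m hm => by
    have := ht (m - n)
    simpa [Nat.add_sub_cancel' hm] using this
  have := (phiW_le_iff_lintegral.1 hφ t).trans hle
  rw [ENNReal.ofReal_le_ofReal_iff (Real.exp_pos _).le, Real.exp_le_exp] at this
  linarith

end truncMgf

/-- **Exponential tilting.** If `x` is interior to the convex hull of the support, there is a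
density which moves the mean to `x` at a cost close to `φ^W(x)`. -/
lemma exists_tilt {ν : Measure ℝ} [IsProbabilityMeasure ν] {x a η : ℝ} (hφ : phiW ν x ≤ a)
    (h1 : ν {w | 0 < 1 * (w - x)} ≠ 0) (h2 : ν {w | 0 < (-1) * (w - x)} ≠ 0) (hη : 0 < η) :
    ∃ (f : ℝ → ℝ≥0∞) (t : ℝ), Measurable f ∧ IsProbabilityMeasure (ν.withDensity f) ∧
      MemLp (fun w => w) 2 (ν.withDensity f) ∧ ∫ w, w ∂ν.withDensity f = x ∧
      ∀ w, f w ≤ ENNReal.ofReal (Real.exp (t * (w - x) + a + η)) := by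
  obtain ⟨n, t, hg, hd⟩ := exists_truncMgf_minimizer hφ h1 h2 hη
  set g := truncMgf ν x n t with hgdef
  have hg0 : 0 < g := (Real.exp_pos _).trans hg
  set A := Set.Icc (x - n) (x + n) with hA
  have hAm : MeasurableSet A := measurableSet_Icc
  -- The vanishing derivative says that this density has mean `x`, its bounded support gives the
  -- second moment, and `g > exp (-(a + η))` gives the pointwise bound.
  let F : ℝ → ℝ := A.indicator fun w => Real.exp (t * (w - x)) / g
  have hF0 : ∀ w, 0 ≤ F w := fun w => Set.indicator_nonneg (fun w _ => by positivity) w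
  have hFm : Measurable F := Measurable.indicator (by fun_prop) hAm
  have hfm : Measurable fun w => ENNReal.ofReal (F w) := by fun_prop
  have hprob : IsProbabilityMeasure (ν.withDensity fun w => ENNReal.ofReal (F w)) := by
    refine ⟨?_⟩
    rw [withDensity_apply _ MeasurableSet.univ, setLIntegral_univ,
      ← ofReal_integral_eq_lintegral_ofReal _ (ae_of_all _ hF0), integral_indicator hAm,
      integral_div, ← truncMgf, ← hgdef, div_self hg0.ne', ENNReal.ofReal_one]
    exact (IntegrableOn.integrable_indicator ((integrable_trunc n t).div_const g) hAm)
  have hmem : ∀ᵐ w ∂(ν.withDensity fun w => ENNReal.ofReal (F w)), w ∈ A := by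
    rw [ae_withDensity_iff hfm]
    refine ae_of_all _ fun w hw => ?_
    by_contra hwA
    simp [F, hwA] at hw
  have hLp : MemLp (fun w => w) 2 (ν.withDensity fun w => ENNReal.ofReal (F w)) := by
    refine MemLp.of_bound (by fun_prop) (|x| + n) ?_
    filter_upwards [hmem] with w hw
    have := abs_le.2 (⟨by linarith [hw.1], by linarith [hw.2]⟩ : -(n : ℝ) ≤ w - x ∧ w - x ≤ n)
    rw [Real.norm_eq_abs]
    linarith [abs_sub_abs_le_abs_sub w x]
  refine ⟨fun w => ENNReal.ofReal (F w), t, hfm, hprob, hLp, ?_, fun w => ?_⟩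
  · have hc : ∫ w, (w - x) ∂(ν.withDensity fun w => ENNReal.ofReal (F w)) = 0 := by
      rw [integral_withDensity_eq_integral_toReal_smul hfm (by simp)]
      have : (fun w => (ENNReal.ofReal (F w)).toReal • (w - x)) =
          A.indicator fun w => (w - x) * Real.exp (t * (w - x)) / g := by
        ext w
        rw [ENNReal.toReal_ofReal (hF0 w)]
        by_cases hw : w ∈ A <;> simp [F, hw]
        ring
      rw [this, integral_indicator hAm, integral_div, hd, zero_div]
    rw [integral_sub (hLp.integrable (by norm_num)) (integrable_const _)] at hc
    simp at hc
    linarith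
  · refine ENNReal.ofReal_le_ofReal ?_
    by_cases hw : w ∈ A
    · simp only [F, Set.indicator_of_mem hw]
      rw [div_le_iff₀ hg0, add_assoc, Real.exp_add]
      have : 1 ≤ Real.exp (a + η) * g := by
        have := mul_le_mul_of_nonneg_left hg.le (Real.exp_pos (a + η)).le
        rwa [← Real.exp_add, add_neg_cancel, Real.exp_zero] at this
      nlinarith [Real.exp_pos (t * (w - x))]
    · simp only [F, Set.indicator_of_notMem hw]
      positivity

/-! ### The divergence of vectors and of cones. -/

lemma mul_phiW_nonneg {ν : Measure ℝ} [IsProbabilityMeasure ν] {p : ℝ} (hp : 0 < p) (x : ℝ) :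
    0 ≤ (p : EReal) * phiW ν x :=
  mul_nonneg (by exact_mod_cast hp.le) (phiW_nonneg _)

section Divergence

variable {Y : Type*} [Fintype Y] {ν : Measure ℝ} {P : Y → ℝ}

lemma coe_sum_ereal (a : Y → ℝ) : ((∑ k, a k : ℝ) : EReal) = ∑ k, (a k : EReal) := by
  classical
  induction (Finset.univ : Finset Y) using Finset.induction_on with
  | empty => simp
  | insert k s hk ih => simp [Finset.sum_insert hk, ih]

lemma divW_le_coe_sum {Q a : Y → ℝ} (hP : ∀ k, 0 < P k) (h : ∀ k, phiW ν (Q k / P k) ≤ a k) :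
    divW ν Q P ≤ (∑ k, P k * a k : ℝ) := by
  rw [coe_sum_ereal]
  refine Finset.sum_le_sum fun k _ => ?_
  rw [EReal.coe_mul]
  exact mul_le_mul_of_nonneg_left (h k) (by exact_mod_cast (hP k).le)

lemma phiW_lt_top_of_divW_lt_top [IsProbabilityMeasure ν] (hP : ∀ k, 0 < P k) {Q : Y → ℝ}
    (h : divW ν Q P < ⊤) (k : Y) : phiW ν (Q k / P k) < ⊤ := by
  refine lt_top_iff_ne_top.2 fun hk => ?_
  have h1 : (P k : EReal) * phiW ν (Q k / P k) ≤ divW ν Q P :=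
    Finset.single_le_sum (f := fun k => (P k : EReal) * phiW ν (Q k / P k))
      (fun k _ => mul_phiW_nonneg (hP k) _) (Finset.mem_univ k)
  rw [hk, EReal.coe_mul_top_of_pos (hP k)] at h1
  exact absurd h (not_lt.2 h1)

lemma exists_of_divW_lt_top [IsProbabilityMeasure ν] (hP : ∀ k, 0 < P k) {Q : Y → ℝ}
    (h : divW ν Q P < ⊤) :
    ∃ a : Y → ℝ, (∀ k, phiW ν (Q k / P k) = a k) ∧ divW ν Q P = (∑ k, P k * a k : ℝ) := by
  choose a ha using fun k => exists_phiW_eq (phiW_lt_top_of_divW_lt_top hP h k)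
  refine ⟨a, ha, ?_⟩
  rw [coe_sum_ereal, divW]
  exact Finset.sum_congr rfl fun k _ => by rw [ha, EReal.coe_mul]

/-- The suprema over the coordinates decouple, so one vector of exponents witnesses the bound; it
defines the half-space used in Chernoff's inequality. -/
lemma exists_of_lt_divW [IsProbabilityMeasure ν] (hP : ∀ k, 0 < P k) {Q : Y → ℝ} {c : ℝ}
    (h : (c : EReal) < divW ν Q P) :
    ∃ t l : Y → ℝ, (∀ k, cumulant ν (t k) = l k) ∧ c < ∑ k, (t k * Q k - P k * l k) := by
  classical
  obtain ⟨b, hb, hc⟩ : ∃ b : Y → ℝ, (∀ k, (b k : EReal) < phiW ν (Q k / P k)) ∧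
      c < ∑ k, P k * b k := by
    have hS : 0 ≤ ∑ k, P k := Finset.sum_nonneg fun k _ => (hP k).le
    by_cases hfin : divW ν Q P < ⊤
    · obtain ⟨a, ha, hsum⟩ := exists_of_divW_lt_top hP hfin
      rw [hsum] at h
      have h : c < ∑ k, P k * a k := by exact_mod_cast h
      -- The slack is spread evenly over the coordinates; the `+ 1` keeps the resulting inequality
      -- strict.
      set δ := (∑ k, P k * a k - c) / (∑ k, P k + 1) with hδ
      have hδ0 : 0 < δ := div_pos (by linarith) (by linarith)
      have hδ1 : δ * (∑ k, P k + 1) = ∑ k, P k * a k - c := div_mul_cancel₀ _ (by linarith)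
      refine ⟨fun k => a k - δ, fun k => ?_, ?_⟩
      · rw [ha]; exact_mod_cast (by linarith : a k - δ < a k)
      · simp only [mul_sub, Finset.sum_sub_distrib, ← Finset.sum_mul]
        nlinarith
    · obtain ⟨j, hj⟩ : ∃ j, phiW ν (Q j / P j) = ⊤ := by
        by_contra hc
        push Not at hc
        choose a ha using fun k => exists_phiW_eq (lt_top_iff_ne_top.2 (hc k))
        exact hfin ((divW_le_coe_sum hP fun k => (ha k).le).trans_lt (EReal.coe_lt_top _))
      -- The infinite coordinate `j` compensates the value `-1` everywhere; the weighted sum is `c +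
      -- 1`.
      refine ⟨fun k => -1 + if k = j then (c + ∑ k, P k + 1) / P j else 0, fun k => ?_, ?_⟩
      · by_cases hk : k = j
        · rw [hk, hj]; exact EReal.coe_lt_top _
        · simp only [hk, if_false]
          exact lt_of_lt_of_le (by exact_mod_cast (by norm_num : (-1 + 0 : ℝ) < 0)) (phiW_nonneg _)
      · simp only [mul_add, Finset.sum_add_distrib, mul_ite, mul_zero, Finset.sum_ite_eq',
          Finset.mem_univ, if_true, mul_div_cancel₀ _ (hP j).ne', mul_neg, mul_one,
          Finset.sum_neg_distrib]
        linarith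
  choose t l htl hlt using fun k => lt_phiW_iff.1 (hb k)
  refine ⟨t, l, htl, hc.trans_le (Finset.sum_le_sum fun k _ => ?_)⟩
  have := mul_le_mul_of_nonneg_left (hlt k).le (hP k).le
  have h2 : P k * (t k * (Q k / P k) - l k) = t k * Q k - P k * l k := by
    field_simp [(hP k).ne']
  linarith

lemma divW_self {ν : Measure ℝ} (hν : IsWeightLaw ν) (hP : ∀ k, 0 < P k) : divW ν P P = 0 := by
  simp [divW, fun k => div_self (hP k).ne', phiW_one hν]

lemma coneDivW_le (ν : Measure ℝ) {A : Set (Y → ℝ)} (P : Y → ℝ) {Q : Y → ℝ} (hQ : Q ∈ A) {m : ℝ}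
    (hm : m ≠ 0) : coneDivW ν A P ≤ divW ν (m • Q) P :=
  iInf₂_le_of_le m hm (iInf₂_le (m • Q) (Set.smul_mem_smul_set hQ))

lemma coneDivW_lt_iff {A : Set (Y → ℝ)} {c : EReal} :
    coneDivW ν A P < c ↔ ∃ m : ℝ, m ≠ 0 ∧ ∃ Q ∈ A, divW ν (m • Q) P < c := by
  simp only [coneDivW, divWSet, iInf_lt_iff]
  constructor
  · rintro ⟨m, hm, _, ⟨Q, hQ, rfl⟩, h⟩
    exact ⟨m, hm, Q, hQ, h⟩
  · rintro ⟨m, hm, Q, hQ, h⟩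
    exact ⟨m, hm, _, ⟨Q, hQ, rfl⟩, h⟩

lemma nbhd_mono (R : Y → ℝ) {r r' : ℝ} (h : r ≤ r') : nbhd r R ⊆ nbhd r' R :=
  fun _ hQ => ⟨hQ.1, fun k => (hQ.2 k).trans h⟩

lemma self_mem_nbhd {R : Y → ℝ} (hR : R ∈ stdSimplex ℝ Y) {r : ℝ} (hr : 0 ≤ r) : R ∈ nbhd r R :=
  ⟨hR, fun k => by simpa using hr⟩

/-- The cone may be completed by its apex without lowering the infimum. -/
lemma coneDivW_le_divW_zero (hν : IsWeightLaw ν) (hP : ∀ k, 0 < P k) {R : Y → ℝ}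
    (hR : R ∈ stdSimplex ℝ Y) {r : ℝ} (hr : 0 ≤ r) : coneDivW ν (nbhd r R) P ≤ divW ν 0 P := by
  have hne : Nonempty Y := by
    by_contra h
    rw [not_nonempty_iff] at h
    simpa using hR.2
  -- With mass `min P` all ratios `m R k / P k` lie in `[0, 1]`, where `φ^W` is at most its value at
  -- `0`.
  obtain ⟨j, -, hj⟩ := Finset.exists_min_image Finset.univ P Finset.univ_nonempty
  refine (coneDivW_le ν P (self_mem_nbhd hR hr) (hP j).ne').trans ?_
  refine Finset.sum_le_sum fun k _ => mul_le_mul_of_nonneg_left ?_ (by exact_mod_cast (hP k).le)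
  refine phiW_antitone hν ?_ ?_
  · simp only [Pi.zero_apply, zero_div, Pi.smul_apply, smul_eq_mul]
    exact div_nonneg (mul_nonneg (hP j).le (hR.1 k)) (hP k).le
  · rw [div_le_one (hP k), Pi.smul_apply, smul_eq_mul]
    have h1 : R k ≤ 1 := hR.2 ▸ Finset.single_le_sum (fun k _ => hR.1 k) (Finset.mem_univ k)
    nlinarith [hj k (Finset.mem_univ k), hP j, hP k, hR.1 k]

end Divergence

/-! ### Mixing points of cones. -/

section Mixing

variable {Y : Type*} [Fintype Y] {ν : Measure ℝ} {P : Y → ℝ}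

lemma divW_convex [IsProbabilityMeasure ν] (hP : ∀ k, 0 < P k) {v w : Y → ℝ} {a b r : ℝ}
    (hv : divW ν v P ≤ a) (hw : divW ν w P ≤ b) (h0 : 0 ≤ r) (h1 : r ≤ 1) :
    divW ν ((1 - r) • v + r • w) P ≤ ((1 - r) * a + r * b : ℝ) := by
  obtain ⟨av, hav, hv'⟩ := exists_of_divW_lt_top hP (hv.trans_lt (EReal.coe_lt_top a))
  obtain ⟨bw, hbw, hw'⟩ := exists_of_divW_lt_top hP (hw.trans_lt (EReal.coe_lt_top b))
  rw [hv'] at hv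
  rw [hw'] at hw
  have hv : ∑ k, P k * av k ≤ a := by exact_mod_cast hv
  have hw : ∑ k, P k * bw k ≤ b := by exact_mod_cast hw
  refine (divW_le_coe_sum hP (a := fun k => (1 - r) * av k + r * bw k) fun k => ?_).trans ?_
  · have := phiW_convex (hav k).le (hbw k).le h0 h1
    convert this using 2
    simp only [Pi.add_apply, Pi.smul_apply, smul_eq_mul]
    ring
  · have : ∑ k, P k * ((1 - r) * av k + r * bw k) =
        (1 - r) * ∑ k, P k * av k + r * ∑ k, P k * bw k := by
      rw [Finset.mul_sum, Finset.mul_sum, ← Finset.sum_add_distrib]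
      exact Finset.sum_congr rfl fun k _ => by ring
    rw [this]
    have := mul_le_mul_of_nonneg_left hv (sub_nonneg.2 h1)
    have := mul_le_mul_of_nonneg_left hw h0
    exact_mod_cast (by linarith)

lemma nonempty_of_mem_stdSimplex {R : Y → ℝ} (hR : R ∈ stdSimplex ℝ Y) : Nonempty Y := by
  by_contra h
  rw [not_nonempty_iff] at h
  simpa using hR.2

lemma radius_nonneg_of_mem_nbhd {Q R : Y → ℝ} {r : ℝ} (hQ : Q ∈ nbhd r R) : 0 ≤ r := by
  obtain ⟨k⟩ := nonempty_of_mem_stdSimplex hQ.1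
  exact (abs_nonneg _).trans (hQ.2 k)

/-- The divergence bounds the total mass. -/
lemma exists_mass_bound (hν : IsWeightLaw ν) (hP : ∀ k, 0 < P k) (hP1 : P ∈ stdSimplex ℝ Y) :
    ∃ t C : ℝ, 0 < t ∧ ∀ (m c : ℝ) (Q : Y → ℝ), Q ∈ stdSimplex ℝ Y → divW ν (m • Q) P ≤ c →
      t * |m| - C ≤ c := by
  have := hν.isProbabilityMeasure
  obtain ⟨t, C, ht, h⟩ := exists_phiW_coercive hν
  refine ⟨t, C, ht, fun m c Q hQ hc => ?_⟩
  obtain ⟨a, ha, hsum⟩ := exists_of_divW_lt_top hP (hc.trans_lt (EReal.coe_lt_top c))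
  rw [hsum] at hc
  have hc : ∑ k, P k * a k ≤ c := by exact_mod_cast hc
  calc t * |m| - C = ∑ k, (t * |m| * Q k - C * P k) := by
        rw [Finset.sum_sub_distrib, ← Finset.mul_sum, ← Finset.mul_sum, hQ.2, hP1.2]; ring
    _ ≤ ∑ k, P k * a k := by
        refine Finset.sum_le_sum fun k _ => ?_
        have h1 := mul_le_mul_of_nonneg_left (h _ _ (ha k).le) (hP k).le
        have h2 : |(m • Q) k / P k| = |m| * Q k / P k := by
          rw [Pi.smul_apply, smul_eq_mul, abs_div, abs_mul, abs_of_nonneg (hQ.1 k),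
            abs_of_pos (hP k)]
        have h3 : P k * (t * (|m| * Q k / P k) - C) = t * |m| * Q k - C * P k := by
          field_simp [(hP k).ne']
        rw [h2, h3] at h1
        exact h1
    _ ≤ c := hc

/-- Masses of equal sign cannot cancel, so the normalized mixture is a convex combination of `Q` and
`Q₀`. The weight `u` of `Q₀` is at least `s κ / (K + κ)`, uniformly in `m`, and the radius drops by
at least this share of `r - r₀`. -/
lemma exists_smul_mixture {R Q Q₀ : Y → ℝ} {r r₀ m m₀ s K κ : ℝ} (hQ : Q ∈ nbhd r R)
    (hQ₀ : Q₀ ∈ nbhd r₀ R) (hr : r₀ ≤ r) (hm : 0 < m₀ * m) (hK : |m| ≤ K) (hκ : |m₀| = κ)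
    (h0 : 0 < s) (h1 : s < 1) :
    ∃ (m' : ℝ) (Q' : Y → ℝ), m' ≠ 0 ∧ Q' ∈ nbhd (r - s * κ / (K + κ) * (r - r₀)) R ∧
      m' • Q' = (1 - s) • m • Q + s • m₀ • Q₀ := by
  have hm' : (1 - s) * m + s * m₀ ≠ 0 := by
    intro h
    have : (1 - s) * m * m₀ + s * m₀ ^ 2 = 0 := by linear_combination m₀ * h
    nlinarith [sq_nonneg m₀, mul_pos (sub_pos.2 h1) hm]
  have hm₀ : m₀ ≠ 0 := by rintro rfl; simp at hm
  have hκ0 : 0 < κ := hκ ▸ abs_pos.2 hm₀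
  have hK0 : 0 ≤ K := (abs_nonneg m).trans hK
  set u := s * m₀ / ((1 - s) * m + s * m₀) with hu
  have hu' : u = s * |m₀| / ((1 - s) * |m| + s * |m₀|) := by
    rcases lt_or_gt_of_ne hm₀ with h | h
    · have : m < 0 := by nlinarith
      rw [hu, abs_of_neg h, abs_of_neg this, ← neg_div_neg_eq]
      ring_nf
    · have : 0 < m := by nlinarith
      rw [hu, abs_of_pos h, abs_of_pos this]
  have hden : 0 < (1 - s) * |m| + s * |m₀| :=
    add_pos_of_nonneg_of_pos (mul_nonneg (by linarith) (abs_nonneg m)) (by positivity)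
  have hu1 : u ≤ 1 := by
    rw [hu', div_le_one hden]
    nlinarith [mul_nonneg (sub_pos.2 h1).le (abs_nonneg m)]
  have hu2 : s * κ / (K + κ) ≤ u := by
    rw [hu', hκ]
    refine div_le_div_of_nonneg_left (by positivity) (hκ ▸ hden) ?_
    nlinarith [abs_nonneg m]
  have hu0 : 0 ≤ u := le_trans (by positivity) hu2
  have hum : ((1 - s) * m + s * m₀) * u = s * m₀ := by rw [hu]; field_simp
  refine ⟨(1 - s) * m + s * m₀, (1 - u) • Q + u • Q₀, hm',
    ⟨convex_stdSimplex ℝ Y hQ.1 hQ₀.1 (by linarith) hu0 (by ring), fun k => ?_⟩, ?_⟩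
  · simp only [Pi.add_apply, Pi.smul_apply, smul_eq_mul]
    calc |(1 - u) * Q k + u * Q₀ k - R k| = |(1 - u) * (Q k - R k) + u * (Q₀ k - R k)| := by
          ring_nf
      _ ≤ |(1 - u) * (Q k - R k)| + |u * (Q₀ k - R k)| := abs_add_le _ _
      _ = (1 - u) * |Q k - R k| + u * |Q₀ k - R k| := by
          rw [abs_mul, abs_mul, abs_of_nonneg hu0, abs_of_nonneg (sub_nonneg.2 hu1)]
      _ ≤ (1 - u) * r + u * r₀ := by
          gcongr
          · exact hQ.2 k
          · exact hQ₀.2 k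
      _ ≤ _ := by nlinarith
  · ext k
    simp only [Pi.add_apply, Pi.smul_apply, smul_eq_mul]
    linear_combination (Q₀ k - Q k) * hum

lemma exists_neg_phiW_lt_top [IsProbabilityMeasure ν] (hP : ∀ k, 0 < P k) {Q : Y → ℝ}
    (hQ : Q ∈ stdSimplex ℝ Y) {m : ℝ} (hm : m < 0) (h : divW ν (m • Q) P < ⊤) :
    ∃ τ > 0, phiW ν (-τ) < ⊤ := by
  obtain ⟨k, -, hk⟩ : ∃ k ∈ Finset.univ, 0 < Q k := by
    by_contra hc
    push Not at hc
    have := Finset.sum_nonpos hc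
    rw [hQ.2] at this
    linarith
  refine ⟨-(m * Q k / P k), ?_, ?_⟩
  · rw [gt_iff_lt, neg_pos]
    exact div_neg_of_neg_of_pos (mul_neg_of_neg_of_pos hm hk) (hP k)
  · rw [neg_neg]
    exact phiW_lt_top_of_divW_lt_top hP h k

/-- For each sign which occurs at all there is a reference point of finite divergence. -/
lemma exists_reference (hν : IsWeightLaw ν) (hP : ∀ k, 0 < P k) {R : Y → ℝ}
    (hR : R ∈ stdSimplex ℝ Y) {ε r : ℝ} (hε : 0 < ε) (hr : r < ε)
    (hfin : coneDivW ν (nbhd r R) P < ⊤) :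
    ∃ r₀ D κ : ℝ, r₀ < ε ∧ ∀ (m : ℝ) (Q : Y → ℝ), m ≠ 0 → Q ∈ stdSimplex ℝ Y →
      divW ν (m • Q) P < ⊤ →
      ∃ m₀ Q₀, 0 < m₀ * m ∧ |m₀| = κ ∧ Q₀ ∈ nbhd r₀ R ∧ divW ν (m₀ • Q₀) P ≤ (D : ℝ) := by
  have := hν.isProbabilityMeasure
  by_cases hneg : ∃ τ > 0, phiW ν (-τ) < ⊤
  · obtain ⟨τ, hτ, hφ⟩ := hneg
    obtain ⟨D, hD⟩ := exists_phiW_eq hφ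
    have := nonempty_of_mem_stdSimplex hR
    obtain ⟨j, -, hj⟩ := Finset.exists_min_image Finset.univ P Finset.univ_nonempty
    -- This size puts the ratios of `κ R` and `-κ R` into `[-τ, 1]`, where `φ^W` is at most
    -- `φ^W(-τ)`; hence `R` itself serves for both signs.
    set κ := min τ 1 * P j with hκ
    have hκ0 : 0 < κ := mul_pos (lt_min hτ one_pos) (hP j)
    refine ⟨0, ∑ k, P k * D, κ, hε, fun m Q hm _ _ => ?_⟩
    have key : ∀ m₀ : ℝ, |m₀| = κ → divW ν (m₀ • R) P ≤ (∑ k, P k * D : ℝ) := by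
      intro m₀ hm₀
      refine divW_le_coe_sum hP fun k => hD ▸ ?_
      have h1 : R k ≤ 1 := hR.2 ▸ Finset.single_le_sum (fun k _ => hR.1 k) (Finset.mem_univ k)
      have h2 : |m₀ * R k / P k| ≤ min τ 1 := by
        rw [abs_div, abs_mul, abs_of_pos (hP k), abs_of_nonneg (hR.1 k), hm₀, div_le_iff₀ (hP k)]
        have := hj k (Finset.mem_univ k)
        calc κ * R k ≤ κ * 1 := by gcongr
          _ ≤ min τ 1 * P k := by rw [mul_one, hκ]; gcongr
      have h3 := abs_le.1 h2
      rw [Pi.smul_apply, smul_eq_mul]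
      exact phiW_antitone hν (by linarith [min_le_left τ 1]) (by linarith [min_le_right τ 1])
    rcases lt_or_gt_of_ne hm with h | h
    · exact ⟨-κ, R, by nlinarith, by rw [abs_neg, abs_of_pos hκ0], self_mem_nbhd hR le_rfl,
        key _ (by rw [abs_neg, abs_of_pos hκ0])⟩
    · exact ⟨κ, R, by positivity, abs_of_pos hκ0, self_mem_nbhd hR le_rfl,
        key _ (abs_of_pos hκ0)⟩
  -- Here negative masses have infinite divergence, so one point of positive mass suffices.
  · have hpos : ∀ (m : ℝ) (Q : Y → ℝ), m ≠ 0 → Q ∈ stdSimplex ℝ Y → divW ν (m • Q) P < ⊤ →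
        0 < m := fun m Q hm hQ h => by
      by_contra hc
      exact hneg (exists_neg_phiW_lt_top hP hQ (lt_of_le_of_ne (not_lt.1 hc) hm) h)
    obtain ⟨m₀, hm₀, Q₀, hQ₀, hlt⟩ := coneDivW_lt_iff.1 hfin
    obtain ⟨a, -, ha⟩ := exists_of_divW_lt_top hP hlt
    have h0 := hpos m₀ Q₀ hm₀ hQ₀.1 hlt
    exact ⟨r, _, m₀, hr, fun m Q hm hQ h => ⟨m₀, Q₀, mul_pos h0 (hpos m Q hm hQ h),
      abs_of_pos h0, hQ₀, ha.le⟩⟩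

/-- Beyond the critical radius the rate has no jumps. -/
lemma exists_coneDivW_le_of_forall_le (hν : IsWeightLaw ν) (hP : ∀ k, 0 < P k)
    (hP1 : P ∈ stdSimplex ℝ Y) {R : Y → ℝ} (hR : R ∈ stdSimplex ℝ Y) {ε r : ℝ} (hε : 0 < ε)
    (hr : r < ε) (hfin : coneDivW ν (nbhd r R) P < ⊤) {c c' : ℝ} (hcc : c < c')
    (h : ∀ β > 1, coneDivW ν (nbhd (β * ε) R) P ≤ c) :
    ∃ α < 1, coneDivW ν (nbhd (α * ε) R) P ≤ c' := by
  have := hν.isProbabilityMeasure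
  obtain ⟨t, C, ht, hmass⟩ := exists_mass_bound hν hP hP1
  obtain ⟨r₀, D, κ, hr₀, href⟩ := exists_reference hν hP hR hε hr hfin
  set b := (c + c') / 2 with hb
  have hbc : c < b := by rw [hb]; linarith
  -- Mixing levels `b` and `D` with weight `s` costs `s (D - b)`, which must not exceed `c' - b`.
  set s := min (1 / 2) ((c' - b) / (|D - b| + 1)) with hs
  have hs0 : 0 < s := lt_min (by norm_num) (div_pos (by rw [hb]; linarith) (by positivity))
  have hs1 : s < 1 := (min_le_left _ _).trans_lt (by norm_num)
  have hsD : (1 - s) * b + s * D ≤ c' := by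
    have h1 : s * (|D - b| + 1) ≤ c' - b := by
      rw [← le_div_iff₀ (by positivity)]; exact min_le_right _ _
    nlinarith [le_abs_self (D - b)]
  set K := (b + C) / t with hK
  have hget : ∀ β > 1, ∃ m Q, m ≠ 0 ∧ Q ∈ nbhd (β * ε) R ∧ divW ν (m • Q) P < b ∧ |m| ≤ K := by
    intro β hβ
    obtain ⟨m, hm, Q, hQ, hlt⟩ := coneDivW_lt_iff.1
      ((h β hβ).trans_lt (by exact_mod_cast hbc : (c : EReal) < b))
    refine ⟨m, Q, hm, hQ, hlt, ?_⟩
    rw [hK, le_div_iff₀ ht]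
    linarith [hmass m b Q hQ.1 hlt.le]
  have hκK : 0 < κ ∧ 0 ≤ K := by
    obtain ⟨m, Q, hm, hQ, hlt, hmK⟩ := hget 2 (by norm_num)
    obtain ⟨m₀, Q₀, hmm, hκ, -⟩ := href m Q hm hQ.1 (hlt.trans (EReal.coe_lt_top b))
    refine ⟨hκ ▸ abs_pos.2 ?_, (abs_nonneg m).trans hmK⟩
    rintro rfl
    simp at hmm
  obtain ⟨hκ0, hK0⟩ := hκK
  set θ := s * κ / (K + κ) with hθ
  have hθ0 : 0 < θ := by positivity
  -- The mass bound `K` holds for all `β > 1`, so `θ` is fixed before `β = 1 + δ` is chosen. The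
  -- radius gained is at least `θ (ε - r₀) = 2 δ ε`, enough to pass from `(1 + δ) ε` to `(1 - δ) ε`.
  set δ := θ * (ε - r₀) / (2 * ε) with hδ
  have hδ0 : 0 < δ := div_pos (mul_pos hθ0 (by linarith)) (by positivity)
  have hδε : δ * ε = θ * (ε - r₀) / 2 := by rw [hδ]; field_simp
  obtain ⟨m, Q, hm, hQ, hlt, hmK⟩ := hget (1 + δ) (by linarith)
  obtain ⟨m₀, Q₀, hmm, hκ, hQ₀, hD⟩ := href m Q hm hQ.1 (hlt.trans (EReal.coe_lt_top b))
  obtain ⟨m', Q', hm', hQ', heq⟩ := exists_smul_mixture hQ hQ₀ (by nlinarith) hmm hmK hκ hs0 hs1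
  refine ⟨1 - δ, by linarith, ?_⟩
  refine (coneDivW_le ν P (nbhd_mono R ?_ hQ') hm').trans ?_
  · rw [← hθ]
    nlinarith [mul_nonneg hθ0.le (mul_nonneg hδ0.le hε.le)]
  · rw [heq]
    exact (divW_convex hP hlt.le hD hs0.le hs1.le).trans (by exact_mod_cast hsD)

/-- A point of the cone may be moved to the interior of all constraints at small cost. -/
lemma exists_interior_point (hν : IsWeightLaw ν) (hP : ∀ k, 0 < P k) (hP1 : P ∈ stdSimplex ℝ Y)
    {R Q : Y → ℝ} {r ε m c : ℝ} (hr : r < ε) (hQ : Q ∈ nbhd r R) (hm : m ≠ 0)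
    (h : divW ν (m • Q) P < c) :
    ∃ v : Y → ℝ, divW ν v P < c ∧
      (∀ (s : ℝ), s ≠ 0 → ∀ k, ν {w | 0 < s * (w - v k / P k)} ≠ 0) ∧
      ∑ k, v k ≠ 0 ∧ ∀ k, 0 < v k / ∑ j, v j ∧ |v k / ∑ j, v j - R k| < ε := by
  have := hν.isProbabilityMeasure
  obtain ⟨a, ha, hsum⟩ := exists_of_divW_lt_top hP (h.trans (EReal.coe_lt_top c))
  -- The point is pushed towards `z P`, where `z` has the sign of `m` and is interior to the convex
  -- hull of the support: the mean `1` for positive mass, `-τ / 2` for negative mass.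
  obtain ⟨z, b, hzm, hzb, hzi⟩ : ∃ z b : ℝ, 0 < z * m ∧ phiW ν z = b ∧
      ∀ s : ℝ, s ≠ 0 → ν {w | 0 < s * (w - z)} ≠ 0 := by
    rcases lt_or_gt_of_ne hm with h0 | h0
    · obtain ⟨τ, hτ, hfin⟩ := exists_neg_phiW_lt_top hP hQ.1 h0 (h.trans (EReal.coe_lt_top c))
      obtain ⟨a', ha'⟩ := exists_phiW_eq hfin
      obtain ⟨b, hb⟩ := exists_phiW_eq ((phiW_antitone hν (by linarith : -τ ≤ -(τ / 2))
        (by linarith)).trans_lt hfin)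
      refine ⟨_, b, by nlinarith, hb, fun s hs => ?_⟩
      have := measure_ne_zero_of_phiW_le (r := (τ / 2) / (1 + τ)) hν ha'.le (by positivity)
        (by rw [div_lt_one (by positivity)]; linarith) s (measure_mean_half_line_ne_zero hν hs)
      convert this using 6
      field_simp
      ring
    · exact ⟨1, 0, by linarith, by simpa using phiW_one hν,
        fun s hs => measure_mean_half_line_ne_zero hν hs⟩
  rw [hsum] at h
  have h : ∑ k, P k * a k < c := by exact_mod_cast h
  let v : ℝ → Y → ℝ := fun s k => (1 - s) * (m * Q k) + s * (z * P k)
  have hvsum : ∀ s, ∑ k, v s k = (1 - s) * m + s * z := fun s => by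
    simp only [v, Finset.sum_add_distrib, ← Finset.mul_sum, hQ.1.2, hP1.2, mul_one]
  have e1 : ∀ᶠ s in 𝓝 (0 : ℝ), (1 - s) * ∑ k, P k * a k + s * b < c :=
    Tendsto.eventually_lt_const h (Continuous.tendsto' (by fun_prop) _ _ (by simp))
  have e2 : ∀ᶠ s in 𝓝 (0 : ℝ), ∀ k, |v s k / ((1 - s) * m + s * z) - R k| < ε := by
    refine eventually_all.2 fun k => ?_
    have hc : ContinuousAt (fun s => |v s k / ((1 - s) * m + s * z) - R k|) 0 := by
      refine (ContinuousAt.sub (ContinuousAt.div (by fun_prop) (by fun_prop) ?_) (by fun_prop)).abs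
      simpa using hm
    refine Tendsto.eventually_lt_const ?_ hc.tendsto
    simpa [v, mul_div_cancel_left₀ _ hm] using (hQ.2 k).trans_lt hr
  obtain ⟨s, ⟨⟨⟨h1, h2⟩, hs1⟩, hs0⟩⟩ := ((((e1.and e2).and (Iio_mem_nhds one_pos)).filter_mono
    nhdsWithin_le_nhds).and (self_mem_nhdsWithin (s := Set.Ioi 0))).exists
  have hs0 : 0 < s := hs0
  have hs1 : s < 1 := hs1
  have hq : ∀ k, v s k / P k = (1 - s) * (m * Q k / P k) + s * z := fun k => by
    have := (hP k).ne'
    simp only [v]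
    field_simp
  have hvm : 0 < ((1 - s) * m + s * z) * m := by
    nlinarith [mul_pos (sub_pos.2 hs1) (mul_self_pos.2 hm)]
  refine ⟨v s, ?_, fun u hu k => ?_, ?_, fun k => ⟨?_, ?_⟩⟩
  · have := divW_le_coe_sum (ν := ν) (Q := v s) hP (a := fun k => (1 - s) * a k + s * b) fun k => by
      rw [hq]
      exact phiW_convex (ha k).le hzb.le hs0.le hs1.le
    refine this.trans_lt (EReal.coe_lt_coe_iff.2 (lt_of_eq_of_lt ?_ h1))
    have hb : s * b = ∑ k, P k * (s * b) := by rw [← Finset.sum_mul, hP1.2, one_mul]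
    conv_rhs => rw [hb]
    rw [Finset.mul_sum, ← Finset.sum_add_distrib]
    exact Finset.sum_congr rfl fun k _ => by ring
  · rw [hq]
    exact measure_ne_zero_of_phiW_le hν (ha k).le hs0 hs1 u (hzi u hu)
  · rw [hvsum]
    rintro h0
    simp [h0] at hvm
  -- All entries and their sum have the sign of `m`, so the normalized entries are positive.
  · have hvk : 0 < v s k * m := by
      have : v s k * m = (1 - s) * (m * m) * Q k + s * (z * m) * P k := by simp only [v]; ring
      rw [this]
      exact add_pos_of_nonneg_of_pos (mul_nonneg (mul_nonneg (by linarith) (mul_self_nonneg m))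
        (hQ.1.1 k)) (mul_pos (mul_pos hs0 hzm) (hP k))
    rw [hvsum, ← mul_div_mul_right _ _ hm]
    exact div_pos hvk hvm
  · rw [hvsum]
    exact h2 k

end Mixing

/-! ### The unnormalized weighted empirical measure. -/

section BlockMean

variable {Y : Type*}

lemma diracAt_of_eq (y : Y) : diracAt y y = 1 := by simp [diracAt]

lemma diracAt_of_ne {y k : Y} (h : k ≠ y) : diracAt y k = 0 := by simp [diracAt, h]

lemma sum_mul_diracAt [Fintype Y] (g : Y → ℝ) (y : Y) : ∑ k, g k * diracAt y k = g y := by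
  rw [Finset.sum_eq_single y (fun k _ hk => by simp [diracAt_of_ne hk]) (by simp)]
  simp [diracAt_of_eq]

/-- The unnormalized weighted empirical measure `(1/n) ∑_{i<n} w_i δ_{s_i}`. -/
noncomputable def blockMean (s : ℕ → Y) (n : ℕ) (w : ℕ → ℝ) (k : Y) : ℝ :=
  (1 / (n : ℝ)) * ∑ i ∈ Finset.range n, w i * diracAt (s i) k

variable [Fintype Y]

lemma sum_mul_blockMean (t : Y → ℝ) (s : ℕ → Y) {n : ℕ} (hn : n ≠ 0) (w : ℕ → ℝ) :
    n * ∑ k, t k * blockMean s n w k = ∑ i ∈ Finset.range n, t (s i) * w i := by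
  have hn' : (n : ℝ) ≠ 0 := by exact_mod_cast hn
  calc n * ∑ k, t k * blockMean s n w k
      = ∑ k, ∑ i ∈ Finset.range n, w i * (t k * diracAt (s i) k) := by
        rw [Finset.mul_sum]
        refine Finset.sum_congr rfl fun k _ => ?_
        rw [blockMean, Finset.mul_sum, Finset.mul_sum, Finset.mul_sum]
        refine Finset.sum_congr rfl fun i _ => ?_
        field_simp
    _ = ∑ i ∈ Finset.range n, t (s i) * w i := by
        rw [Finset.sum_comm]
        refine Finset.sum_congr rfl fun i _ => ?_
        rw [← Finset.mul_sum, sum_mul_diracAt, mul_comm]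

lemma sum_mul_empirical (t : Y → ℝ) (s : ℕ → Y) {n : ℕ} (hn : n ≠ 0) :
    n * ∑ k, empirical s n k * t k = ∑ i ∈ Finset.range n, t (s i) := by
  have h := sum_mul_blockMean t s hn fun _ => 1
  simp only [blockMean, one_mul, mul_one] at h
  rw [← h]
  simp only [empirical, mul_comm]

lemma sum_blockMean (s : ℕ → Y) {n : ℕ} (hn : n ≠ 0) (w : ℕ → ℝ) :
    n * ∑ k, blockMean s n w k = ∑ i ∈ Finset.range n, w i := by
  simpa using sum_mul_blockMean (fun _ => 1) s hn w

/-- The vectors whose normalization lies in the neighbourhood `V_r(R)`. -/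
def coneOver (r : ℝ) (R : Y → ℝ) : Set (Y → ℝ) :=
  {b | ∑ k, b k ≠ 0 ∧ (fun k => b k / ∑ j, b j) ∈ nbhd r R}

/-- The factor `1 / n` cancels on normalization; when the weights sum to `0`, the value `⊤` matches
no real vector. -/
lemma exists_normWeighted_iff (x : ℕ → Y) (w : ℕ → ℝ) {n : ℕ} (hn : n ≠ 0) (A : Set (Y → ℝ)) :
    (∃ Q : Y → ℝ, Q ∈ A ∧ normWeighted x w n = fun k => (Q k : EReal)) ↔
      ∑ k, blockMean x n w k ≠ 0 ∧ (fun k => blockMean x n w k / ∑ j, blockMean x n w j) ∈ A := by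
  have hn' : (n : ℝ) ≠ 0 := by exact_mod_cast hn
  by_cases h0 : ∑ j ∈ Finset.range n, w j = 0
  · have hb : ∑ k, blockMean x n w k = 0 := by
      have := sum_blockMean x hn w
      rw [h0] at this
      simpa [hn] using this
    simp only [hb, ne_eq, not_true_eq_false, false_and, iff_false]
    rintro ⟨Q, -, hQ⟩
    have := congrFun hQ (x 0)
    simp only [normWeighted, h0, if_true] at this
    exact EReal.coe_ne_top _ this.symm
  · have hb : ∑ k, blockMean x n w k ≠ 0 := by
      intro h
      rw [← sum_blockMean x hn w, h, mul_zero] at h0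
      exact h0 rfl
    have key : normWeighted x w n =
        fun k => ((blockMean x n w k / ∑ j : Y, blockMean x n w j : ℝ) : EReal) := by
      ext k
      simp only [normWeighted, h0, if_false]
      congr 1
      have h1 : ∑ i ∈ Finset.range n, w i / (∑ j ∈ Finset.range n, w j) * diracAt (x i) k =
          (∑ i ∈ Finset.range n, w i * diracAt (x i) k) / ∑ j ∈ Finset.range n, w j := by
        rw [Finset.sum_div]
        exact Finset.sum_congr rfl fun i _ => by ring
      have h2 : blockMean x n w k = (1 / (n : ℝ)) * ∑ i ∈ Finset.range n, w i * diracAt (x i) k :=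
        rfl
      rw [h1, h2, ← sum_blockMean x hn w]
      field_simp
    rw [key]
    simp only [ne_eq, hb, not_false_eq_true, true_and]
    constructor
    · rintro ⟨Q, hQ, h⟩
      have : (fun k => blockMean x n w k / ∑ j : Y, blockMean x n w j) = Q := by
        ext k
        exact_mod_cast congrFun h k
      rwa [this]
    · exact fun h => ⟨_, h, rfl⟩

end BlockMean

/-! ### Exponential decay rates. -/

section Decay

variable {Y Ω : Type*} [MeasurableSpace Ω] {μ : Measure Ω} {s : ℕ → Y} {W : ℕ → Ω → ℝ}

lemma lintegral_exp_sum {ν : Measure ℝ} (hWm : ∀ i, Measurable (W i)) (hWi : iIndepFun W μ)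
    (hWlaw : ∀ i, μ.map (W i) = ν) (t l : Y → ℝ) (htl : ∀ k, cumulant ν (t k) = l k) (n : ℕ) :
    ∫⁻ ω, ENNReal.ofReal (Real.exp (∑ i ∈ Finset.range n, t (s i) * W i ω)) ∂μ =
      ENNReal.ofReal (Real.exp (∑ i ∈ Finset.range n, l (s i))) := by
  simp_rw [Real.exp_sum, ENNReal.ofReal_prod_of_nonneg fun _ _ => (Real.exp_pos _).le]
  rw [lintegral_prod_eq_prod_lintegral_of_indepFun (Finset.range n)
    (fun i ω => ENNReal.ofReal (Real.exp (t (s i) * W i ω)))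
    (hWi.comp (fun i w => ENNReal.ofReal (Real.exp (t (s i) * w))) (fun i => by fun_prop))
    (fun i => by have := hWm i; fun_prop)]
  refine Finset.prod_congr rfl fun i _ => ?_
  rw [← cumulant_eq_coe_iff.1 (htl (s i)), ← hWlaw i, lintegral_map (by fun_prop) (hWm i)]

/-- The unnormalized weighted empirical measures fall into `A` with probability decaying at any
exponential rate below `a`. -/
def HasDecay (μ : Measure Ω) (s : ℕ → Y) (W : ℕ → Ω → ℝ) (a : ℝ) (A : Set (Y → ℝ)) : Prop :=
  ∀ a' < a, ∀ᶠ n : ℕ in atTop,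
    μ {ω | blockMean s n (fun i => W i ω) ∈ A} ≤ ENNReal.ofReal (Real.exp (-(n * a')))

lemma HasDecay.mono {a : ℝ} {A B : Set (Y → ℝ)} (hB : HasDecay μ s W a B) (h : A ⊆ B) :
    HasDecay μ s W a A := fun a' ha' => by
  filter_upwards [hB a' ha'] with n hn
  exact le_trans (measure_mono fun ω hω => h hω) hn

/-- Any loss in the rate absorbs a factor `2`; hence `HasDecay`, which asks only for rates below
`a`, is stable under finite unions. -/
lemma eventually_two_mul_exp_le {a b : ℝ} (h : a < b) :
    ∀ᶠ n : ℕ in atTop, 2 * Real.exp (-(n * b)) ≤ Real.exp (-(n * a)) := by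
  have : Tendsto (fun n : ℕ => (n : ℝ) * (b - a)) atTop atTop :=
    tendsto_natCast_atTop_atTop.atTop_mul_const (sub_pos.2 h)
  filter_upwards [this.eventually_ge_atTop 1] with n hn
  have h1 : Real.exp (-(n * a)) = Real.exp (n * (b - a)) * Real.exp (-(n * b)) := by
    rw [← Real.exp_add]; ring_nf
  rw [h1]
  gcongr
  linarith [Real.add_one_le_exp ((n : ℝ) * (b - a))]

lemma HasDecay.union {a : ℝ} {A B : Set (Y → ℝ)} (hA : HasDecay μ s W a A)
    (hB : HasDecay μ s W a B) : HasDecay μ s W a (A ∪ B) := fun a' ha' => by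
  obtain ⟨b, hb, hba⟩ := exists_between ha'
  filter_upwards [hA b hba, hB b hba, eventually_two_mul_exp_le hb] with n h1 h2 h3
  calc _ ≤ μ ({ω | blockMean s n (fun i => W i ω) ∈ A} ∪
        {ω | blockMean s n (fun i => W i ω) ∈ B}) := measure_mono fun ω hω => hω
    _ ≤ _ := measure_union_le _ _
    _ ≤ ENNReal.ofReal (Real.exp (-(n * b))) + ENNReal.ofReal (Real.exp (-(n * b))) :=
        add_le_add h1 h2
    _ = ENNReal.ofReal (2 * Real.exp (-(n * b))) := by
        rw [← ENNReal.ofReal_add (Real.exp_pos _).le (Real.exp_pos _).le, two_mul]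
    _ ≤ _ := ENNReal.ofReal_le_ofReal h3

lemma hasDecay_empty (a : ℝ) : HasDecay μ s W a ∅ := fun a' _ => by
  simp

lemma hasDecay_iUnion {ι : Type*} [Finite ι] {a : ℝ} {A : ι → Set (Y → ℝ)}
    (h : ∀ i, HasDecay μ s W a (A i)) : HasDecay μ s W a (⋃ i, A i) := by
  classical
  have := Fintype.ofFinite ι
  have key : ∀ F : Finset ι, HasDecay μ s W a (⋃ i ∈ F, A i) := fun F => by
    induction F using Finset.induction_on with
    | empty => simpa using hasDecay_empty a
    | insert i F _ ih =>
      rw [Finset.set_biUnion_insert]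
      exact (h i).union ih
  simpa using key Finset.univ

end Decay

/-! ### The large deviation upper bound. -/

section UpperBound

variable {Y Ω : Type*} [Fintype Y] [MeasurableSpace Ω] {μ : Measure Ω}
  {ν : Measure ℝ} {s : ℕ → Y} {W : ℕ → Ω → ℝ}

/-- Chernoff's inequality, with the exponent of each weight chosen by its sample point. -/
lemma measure_le_exp_of_cumulant (hWm : ∀ i, Measurable (W i)) (hWi : iIndepFun W μ)
    (hWlaw : ∀ i, μ.map (W i) = ν) (t l : Y → ℝ) (htl : ∀ k, cumulant ν (t k) = l k) {n : ℕ}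
    (hn : n ≠ 0) (c : ℝ) :
    μ {ω | c ≤ ∑ k, t k * blockMean s n (fun i => W i ω) k} ≤
      ENNReal.ofReal (Real.exp (n * (∑ k, empirical s n k * l k - c))) := by
  have hn' : (0 : ℝ) < n := by positivity
  have h := mul_meas_ge_le_lintegral (μ := μ)
    (f := fun ω => ENNReal.ofReal (Real.exp (∑ i ∈ Finset.range n, t (s i) * W i ω)))
    (by fun_prop) (ENNReal.ofReal (Real.exp (n * c)))
  rw [lintegral_exp_sum hWm hWi hWlaw t l htl] at h
  have hset : {ω | ENNReal.ofReal (Real.exp (n * c)) ≤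
      ENNReal.ofReal (Real.exp (∑ i ∈ Finset.range n, t (s i) * W i ω))} =
      {ω | c ≤ ∑ k, t k * blockMean s n (fun i => W i ω) k} := by
    ext ω
    rw [Set.mem_ofPred_eq, Set.mem_ofPred_eq, ENNReal.ofReal_le_ofReal_iff (Real.exp_pos _).le,
      Real.exp_le_exp, ← sum_mul_blockMean t s hn, mul_le_mul_iff_right₀ hn']
  rw [hset, ← sum_mul_empirical l s hn] at h
  rw [mul_sub, Real.exp_sub, ENNReal.ofReal_div_of_pos (Real.exp_pos _),
    ENNReal.le_div_iff_mul_le (by simp [Real.exp_pos]) (by simp), mul_comm]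
  exact h

lemma hasDecay_halfSpace (hWm : ∀ i, Measurable (W i)) (hWi : iIndepFun W μ)
    (hWlaw : ∀ i, μ.map (W i) = ν) {P : Y → ℝ}
    (hs : ∀ k, Tendsto (fun n => empirical s n k) atTop (𝓝 (P k)))
    {t l : Y → ℝ} (htl : ∀ k, cumulant ν (t k) = l k) (a : ℝ) :
    HasDecay μ s W a {b | a + ∑ k, P k * l k ≤ ∑ k, t k * b k} := by
  intro a' ha'
  have hlim : Tendsto (fun n => ∑ k, empirical s n k * l k) atTop (𝓝 (∑ k, P k * l k)) :=
    tendsto_finsetSum _ fun k _ => (hs k).mul_const _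
  filter_upwards [hlim.eventually_lt_const (by linarith : ∑ k, P k * l k <
    a + ∑ k, P k * l k - a'), eventually_ne_atTop 0] with n hn hn0
  refine (measure_le_exp_of_cumulant hWm hWi hWlaw t l htl hn0 _).trans
    (ENNReal.ofReal_le_ofReal (Real.exp_le_exp.2 ?_))
  rw [← mul_neg]
  exact mul_le_mul_of_nonneg_left (by linarith) n.cast_nonneg

/-- Exponential tightness. -/
lemma exists_hasDecay_compl_closedBall (hν : IsWeightLaw ν) (hWm : ∀ i, Measurable (W i))
    (hWi : iIndepFun W μ) (hWlaw : ∀ i, μ.map (W i) = ν) {P : Y → ℝ} (hP1 : P ∈ stdSimplex ℝ Y)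
    (hs : ∀ k, Tendsto (fun n => empirical s n k) atTop (𝓝 (P k))) (a : ℝ) :
    ∃ ρ, HasDecay μ s W a (Metric.closedBall 0 ρ)ᶜ := by
  classical
  have := hν.isProbabilityMeasure
  obtain ⟨t, C, ht, ⟨l, hl, hlC⟩, ⟨l', hl', hlC'⟩⟩ := exists_pos_cumulant hν
  have key : ∀ (u l : ℝ) (_ : cumulant ν u = l) (_ : l ≤ C) (k : Y),
      HasDecay μ s W a {b | |a| + |C| ≤ u * b k} := by
    intro u l hl hlC k
    have htl : ∀ j, cumulant ν (if j = k then u else 0) = ((if j = k then l else 0 : ℝ) : EReal) := by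
      intro j
      by_cases hj : j = k
      · simpa [hj] using hl
      · simpa [hj] using cumulant_zero
    refine (hasDecay_halfSpace hWm hWi hWlaw hs htl a).mono fun b hb => ?_
    simp only [Set.mem_ofPred_eq, mul_ite, ite_mul, mul_zero, zero_mul, Finset.sum_ite_eq',
      Finset.mem_univ, if_true] at hb ⊢
    have h1 : P k ≤ 1 := hP1.2 ▸ Finset.single_le_sum (fun k _ => hP1.1 k) (Finset.mem_univ k)
    have h2 : P k * l ≤ |C| := by
      calc P k * l ≤ P k * |C| :=
            mul_le_mul_of_nonneg_left (hlC.trans (le_abs_self C)) (hP1.1 k)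
        _ ≤ 1 * |C| := by gcongr
        _ = |C| := one_mul _
    linarith [le_abs_self a]
  refine ⟨(|a| + |C|) / t, ((hasDecay_iUnion fun k => key t l hl hlC k).union
    (hasDecay_iUnion fun k => key (-t) l' hl' hlC' k)).mono fun b hb => ?_⟩
  rw [Set.mem_compl_iff, mem_closedBall_zero_iff, pi_norm_le_iff_of_nonneg (by positivity)] at hb
  push Not at hb
  obtain ⟨k, hk⟩ := hb
  rw [div_lt_iff₀ ht, Real.norm_eq_abs] at hk
  rcases abs_cases (b k) with ⟨h, -⟩ | ⟨h, -⟩ <;> rw [h] at hk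
  · exact Or.inl (Set.mem_iUnion.2 ⟨k, by rw [Set.mem_ofPred_eq]; linarith⟩)
  · exact Or.inr (Set.mem_iUnion.2 ⟨k, by rw [Set.mem_ofPred_eq]; linarith⟩)

/-- The large deviation upper bound for closed sets. -/
lemma hasDecay_of_isClosed (hν : IsWeightLaw ν) (hWm : ∀ i, Measurable (W i))
    (hWi : iIndepFun W μ) (hWlaw : ∀ i, μ.map (W i) = ν) {P : Y → ℝ} (hP : ∀ k, 0 < P k)
    (hP1 : P ∈ stdSimplex ℝ Y) (hs : ∀ k, Tendsto (fun n => empirical s n k) atTop (𝓝 (P k)))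
    {F : Set (Y → ℝ)} (hF : IsClosed F) {a : ℝ} (ha : ∀ b ∈ F, (a : EReal) < divW ν b P) :
    HasDecay μ s W a F := by
  have := hν.isProbabilityMeasure
  obtain ⟨ρ, hρ⟩ := exists_hasDecay_compl_closedBall hν hWm hWi hWlaw hP1 hs a
  have hK : HasDecay μ s W a (Metric.closedBall 0 ρ ∩ F) := by
    refine ((isCompact_closedBall 0 ρ).inter_right hF).induction_on (hasDecay_empty a)
      (fun A B h hB => hB.mono h) (fun A B hA hB => hA.union hB) fun b hb => ?_
    obtain ⟨t, l, htl, hlt⟩ := exists_of_lt_divW hP (ha b hb.2)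
    refine ⟨{b | a + ∑ k, P k * l k ≤ ∑ k, t k * b k}, mem_nhdsWithin_of_mem_nhds ?_,
      hasDecay_halfSpace hWm hWi hWlaw hs htl a⟩
    rw [Finset.sum_sub_distrib] at hlt
    have hc : Continuous fun b : Y → ℝ => ∑ k, t k * b k := by fun_prop
    filter_upwards [hc.continuousAt.eventually_const_lt
      (by linarith : a + ∑ k, P k * l k < ∑ k, t k * b k)] with b' hb'
    exact hb'.le
  refine (hK.union hρ).mono fun b hb => ?_
  by_cases h : b ∈ Metric.closedBall 0 ρ
  · exact Or.inl ⟨h, hb⟩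
  · exact Or.inr h

/-- The upper bound for the cone over a neighbourhood. -/
lemma eventually_measure_coneOver_le (hν : IsWeightLaw ν) (hWm : ∀ i, Measurable (W i))
    (hWi : iIndepFun W μ) (hWlaw : ∀ i, μ.map (W i) = ν) {P R : Y → ℝ} (hP : ∀ k, 0 < P k)
    (hP1 : P ∈ stdSimplex ℝ Y) (hR : R ∈ stdSimplex ℝ Y) {x : ℕ → Y}
    (hx : ∀ k, Tendsto (fun n => empirical x n k) atTop (𝓝 (R k)))
    (hs : ∀ k, Tendsto (fun n => empirical s n k) atTop (𝓝 (P k))) {ε r a : ℝ} (hε : 0 < ε)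
    (hr : ε < r) (ha : (a : EReal) < coneDivW ν (nbhd r R) P) :
    ∀ᶠ n : ℕ in atTop, μ {ω | blockMean s n (fun i => W i ω) ∈ coneOver ε (empirical x n)} ≤
      ENNReal.ofReal (Real.exp (-(n * a))) := by
  obtain ⟨a', haa', ha'⟩ := EReal.exists_between_coe_real ha
  -- Multiplying the constraints by powers of the total mass avoids division, so `F` is closed for
  -- masses of both signs; total mass `0` forces `b = 0`.
  let F : Set (Y → ℝ) := {b | (∀ k, 0 ≤ b k * ∑ j, b j) ∧
    ∀ k, |b k - (∑ j, b j) * R k| ≤ |∑ j, b j| * r}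
  have hFc : IsClosed F := by
    simp only [F, Set.ofPred_and, Set.ofPred_forall]
    exact (isClosed_iInter fun k => isClosed_le (by fun_prop) (by fun_prop)).inter
      (isClosed_iInter fun k => isClosed_le (by fun_prop) (by fun_prop))
  have hF : ∀ b ∈ F, (a' : EReal) < divW ν b P := by
    rintro b ⟨hb1, hb2⟩
    refine ha'.trans_le ?_
    by_cases h0 : ∑ j, b j = 0
    · have : b = 0 := by
        ext k
        simpa [h0] using hb2 k
      rw [this]
      exact coneDivW_le_divW_zero hν hP hR (hε.trans hr).le
    · have hmem : (fun k => b k / ∑ j, b j) ∈ nbhd r R := by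
        refine ⟨⟨fun k => ?_, ?_⟩, fun k => ?_⟩
        · have : b k / ∑ j, b j = b k * (∑ j, b j) / (∑ j, b j) ^ 2 := by field_simp
          refine le_of_le_of_eq ?_ this.symm
          exact div_nonneg (hb1 k) (sq_nonneg _)
        · rw [← Finset.sum_div, div_self h0]
        · have : b k / ∑ j, b j - R k = (b k - (∑ j, b j) * R k) / ∑ j, b j := by
            rw [sub_div, mul_div_cancel_left₀ _ h0]
          rw [this, abs_div, div_le_iff₀ (abs_pos.2 h0), mul_comm r]
          exact hb2 k
      have := coneDivW_le ν P hmem h0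
      convert this using 2
      ext k
      simp only [Pi.smul_apply, smul_eq_mul]
      field_simp
  have hdec := hasDecay_of_isClosed hν hWm hWi hWlaw hP hP1 hs hFc hF a (by exact_mod_cast haa')
  have hclose : ∀ᶠ n in atTop, ∀ k, |empirical x n k - R k| < r - ε := eventually_all.2 fun k => by
    refine Tendsto.eventually_lt_const (sub_pos.2 hr) ?_
    simpa using ((hx k).sub_const (R k)).abs
  filter_upwards [hdec, hclose] with n hn hcl
  refine (measure_mono fun ω hω => ?_).trans hn
  obtain ⟨h0, ⟨h1, -⟩, h2⟩ := hω
  refine ⟨fun k => ?_, fun k => ?_⟩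
  · have := mul_nonneg (h1 k) (sq_nonneg (∑ j, blockMean s n (fun i => W i ω) j))
    simp only at this
    rwa [sq, ← mul_assoc, div_mul_cancel₀ _ h0] at this
  · set m := ∑ j, blockMean s n (fun i => W i ω) j
    have h3 : blockMean s n (fun i => W i ω) k - m * R k =
        m * ((blockMean s n (fun i => W i ω) k / m - empirical x n k) +
          (empirical x n k - R k)) := by field_simp; ring
    rw [h3, abs_mul]
    refine mul_le_mul_of_nonneg_left ?_ (abs_nonneg m)
    refine (abs_add_le _ _).trans ?_
    linarith [h2 k, hcl k]

end UpperBound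

/-! ### The large deviation lower bound. -/

section LowerBound

lemma pi_withDensity_eq {ι : Type*} [Fintype ι] {ν : Measure ℝ} [IsProbabilityMeasure ν]
    {g : ι → ℝ → ℝ≥0∞} (hg : ∀ i, Measurable (g i))
    [∀ i, IsProbabilityMeasure (ν.withDensity (g i))] :
    Measure.pi (fun i => ν.withDensity (g i)) =
      (Measure.pi fun _ : ι => ν).withDensity fun u => ∏ i, g i (u i) := by
  refine Measure.pi_eq fun A hA => ?_
  rw [withDensity_apply _ (MeasurableSet.univ_pi hA), ← lintegral_indicator (.univ_pi hA)]
  have h1 : (Set.univ.pi A).indicator (fun u : ι → ℝ => ∏ i, g i (u i)) =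
      fun u => ∏ i, (A i).indicator (g i) (u i) := by
    classical
    ext u
    by_cases hu : u ∈ Set.univ.pi A
    · rw [Set.indicator_of_mem hu]
      exact Finset.prod_congr rfl fun i _ => (Set.indicator_of_mem (hu i trivial) _).symm
    · rw [Set.indicator_of_notMem hu]
      obtain ⟨i, hi⟩ : ∃ i, u i ∉ A i := by simpa using hu
      exact (Finset.prod_eq_zero (Finset.mem_univ i) (Set.indicator_of_notMem hi _)).symm
  have hm : ∀ i, Measurable ((A i).indicator (g i)) := fun i => (hg i).indicator (hA i)
  rw [h1, lintegral_prod_eq_prod_lintegral_of_indepFun Finset.univ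
    (fun i (u : ι → ℝ) => (A i).indicator (g i) (u i))
    (iIndepFun_pi fun i => (hm i).aemeasurable)
    (fun i => (hm i).comp (measurable_pi_apply i))]
  refine Finset.prod_congr rfl fun i _ => ?_
  rw [(measurePreserving_eval (fun _ : ι => ν) i).lintegral_comp (hm i),
    lintegral_indicator (hA i), withDensity_apply _ (hA i)]

variable {Y : Type*}

/-- The centred sum of the variables belonging to the point `k`. -/
noncomputable def centredSum (s : ℕ → Y) (x : Y → ℝ) (n : ℕ) (k : Y) (u : Fin n → ℝ) : ℝ :=
  ∑ i : Fin n, (u i - x (s i)) * diracAt (s i) k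

lemma measurable_centredSum (s : ℕ → Y) (x : Y → ℝ) (n : ℕ) (k : Y) :
    Measurable (centredSum s x n k) := by
  unfold centredSum
  fun_prop

lemma sum_mul_centredSum [Fintype Y] (t : Y → ℝ) (s : ℕ → Y) (x : Y → ℝ) (n : ℕ) (u : Fin n → ℝ) :
    ∑ k, t k * centredSum s x n k u = ∑ i : Fin n, t (s i) * (u i - x (s i)) := by
  simp only [centredSum, Finset.mul_sum]
  rw [Finset.sum_comm]
  refine Finset.sum_congr rfl fun i _ => ?_
  rw [← sum_mul_diracAt t (s i), Finset.sum_mul]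
  exact Finset.sum_congr rfl fun k _ => by ring

lemma centredSum_eq (s : ℕ → Y) (x : Y → ℝ) {n : ℕ} (hn : n ≠ 0) (k : Y) (w : ℕ → ℝ) :
    centredSum s x n k (fun i => w i) = n * (blockMean s n w k - empirical s n k * x k) := by
  have hn' : (n : ℝ) ≠ 0 := by exact_mod_cast hn
  have h1 : ∀ i : Fin n, (w i - x (s i)) * diracAt (s i) k =
      w i * diracAt (s i) k - diracAt (s i) k * x k := fun i => by
    by_cases h : k = s i
    · rw [h]; ring
    · rw [diracAt_of_ne h]; ring
  simp only [centredSum, h1, Finset.sum_sub_distrib, ← Finset.sum_mul]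
  rw [Fin.sum_univ_eq_sum_range (fun i => w i * diracAt (s i) k),
    Fin.sum_univ_eq_sum_range (fun i => diracAt (s i) k), blockMean, empirical]
  field_simp

/-- Chebyshev's inequality: the variance of the sum is at most `n` times the sum of the variances
over all points. -/
lemma measure_le_abs_centredSum [Fintype Y] {σ : Y → Measure ℝ} [∀ k, IsProbabilityMeasure (σ k)]
    (hσ : ∀ k, MemLp (fun w => w) 2 (σ k)) {x : Y → ℝ} (hx : ∀ k, ∫ w, w ∂σ k = x k)
    (s : ℕ → Y) {n : ℕ} (hn : n ≠ 0) {δ : ℝ} (hδ : 0 < δ) (k : Y) :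
    (Measure.pi fun i : Fin n => σ (s i)) {u | n * δ ≤ |centredSum s x n k u|} ≤
      ENNReal.ofReal ((∑ k, variance (fun w => w) (σ k)) / δ ^ 2 * (1 / n)) := by
  have hn' : (0 : ℝ) < n := by positivity
  let X : Fin n → ℝ → ℝ := fun i w => (w - x (s i)) * diracAt (s i) k
  have hX : ∀ i, MemLp (X i) 2 (σ (s i)) := fun i =>
    ((hσ (s i)).sub (memLp_const _)).mul_const _
  have hXe : ∀ i : Fin n, MemLp (fun u : Fin n → ℝ => X i (u i)) 2
      (Measure.pi fun i : Fin n => σ (s i)) := fun i =>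
    (hX i).comp_measurePreserving (measurePreserving_eval (fun i : Fin n => σ (s i)) i)
  have hmean : ∫ u, centredSum s x n k u ∂(Measure.pi fun i : Fin n => σ (s i)) = 0 := by
    simp only [centredSum]
    rw [integral_finsetSum _ fun i _ => (hXe i).integrable (by norm_num)]
    refine Finset.sum_eq_zero fun i _ => ?_
    have h1 := integral_comp_eval (μ := fun i : Fin n => σ (s i)) (i := i)
      (hX i).aestronglyMeasurable
    refine h1.trans ?_
    simp only [X]
    rw [integral_mul_const, integral_sub ((hσ _).integrable (by norm_num)) (integrable_const _), hx]
    simp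
  have hfun : centredSum s x n k = ∑ i : Fin n, fun u : Fin n → ℝ => X i (u i) := by
    ext u
    simp [centredSum, X]
  have hvar : variance (centredSum s x n k) (Measure.pi fun i : Fin n => σ (s i)) ≤
      n * ∑ k, variance (fun w => w) (σ k) := by
    rw [hfun, variance_sum_pi hX]
    have : ∀ i : Fin n, variance (X i) (σ (s i)) ≤ ∑ k, variance (fun w => w) (σ k) := fun i => by
      have h1 : variance (X i) (σ (s i)) =
          diracAt (s i) k ^ 2 * variance (fun w => w) (σ (s i)) := by
        simp only [X, mul_comm _ (diracAt (s i) k)]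
        rw [variance_const_mul, variance_sub_const (by fun_prop)]
      have h2 : diracAt (s i) k ^ 2 ≤ 1 := by
        by_cases h : k = s i
        · rw [h, diracAt_of_eq]; norm_num
        · rw [diracAt_of_ne h]; norm_num
      rw [h1]
      calc _ ≤ 1 * variance (fun w => w) (σ (s i)) :=
            mul_le_mul_of_nonneg_right h2 (variance_nonneg _ _)
        _ ≤ _ := by
            rw [one_mul]
            exact Finset.single_le_sum (f := fun k => variance (fun w => w) (σ k))
              (fun k _ => variance_nonneg _ _) (Finset.mem_univ (s i))
    calc _ ≤ ∑ _i : Fin n, ∑ k, variance (fun w => w) (σ k) := Finset.sum_le_sum fun i _ => this i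
      _ = _ := by simp
  have hL : MemLp (centredSum s x n k) 2 (Measure.pi fun i : Fin n => σ (s i)) := by
    rw [hfun]
    exact memLp_finsetSum' _ fun i _ => hXe i
  have hcheb := meas_ge_le_variance_div_sq hL (mul_pos hn' hδ)
  simp only [hmean, sub_zero] at hcheb
  refine hcheb.trans (ENNReal.ofReal_le_ofReal ?_)
  rw [div_le_iff₀ (by positivity)]
  refine hvar.trans (le_of_eq ?_)
  field_simp

/-- Under a tilted product law the weighted empirical measure concentrates at its mean. -/
lemma eventually_half_le_pi [Fintype Y] {σ : Y → Measure ℝ} [∀ k, IsProbabilityMeasure (σ k)]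
    (hσ : ∀ k, MemLp (fun w => w) 2 (σ k)) {x : Y → ℝ} (hx : ∀ k, ∫ w, w ∂σ k = x k)
    (s : ℕ → Y) {δ : ℝ} (hδ : 0 < δ) :
    ∀ᶠ n : ℕ in atTop, (1 / 2 : ℝ≥0∞) ≤
      (Measure.pi fun i : Fin n => σ (s i)) {u | ∀ k, |centredSum s x n k u| < n * δ} := by
  set V := (∑ k, variance (fun w => w) (σ k)) / δ ^ 2
  have hlim : Tendsto (fun n : ℕ => ∑ _k : Y, ENNReal.ofReal (V * (1 / (n : ℝ)))) atTop (𝓝 0) := by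
    have h1 : Tendsto (fun n : ℕ => V * (1 / (n : ℝ))) atTop (𝓝 0) := by
      simpa using tendsto_one_div_atTop_nhds_zero_nat.const_mul V
    have h2 := tendsto_finsetSum (Finset.univ : Finset Y) fun _ _ => ENNReal.tendsto_ofReal h1
    simpa using h2
  filter_upwards [hlim.eventually_le_const (by norm_num : (0 : ℝ≥0∞) < 1 / 2),
    eventually_ne_atTop 0] with n hn hn0
  have hm : MeasurableSet {u : Fin n → ℝ | ∀ k, |centredSum s x n k u| < n * δ} := by
    simp only [Set.ofPred_forall]
    exact MeasurableSet.iInter fun k =>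
      measurableSet_lt (measurable_centredSum s x n k).abs measurable_const
  have hcompl : {u : Fin n → ℝ | ∀ k, |centredSum s x n k u| < n * δ}ᶜ =
      ⋃ k, {u | n * δ ≤ |centredSum s x n k u|} := by
    ext u
    simp
  have hbad : (Measure.pi fun i : Fin n => σ (s i))
      {u | ∀ k, |centredSum s x n k u| < n * δ}ᶜ ≤ 1 / 2 := by
    rw [hcompl]
    refine (measure_iUnion_fintype_le _ _).trans (le_trans (Finset.sum_le_sum fun k _ => ?_) hn)
    exact measure_le_abs_centredSum hσ hx s hn0 hδ k
  have hadd := prob_add_prob_compl (μ := Measure.pi fun i : Fin n => σ (s i)) hm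
  by_contra hc
  rw [not_le] at hc
  have : (Measure.pi fun i : Fin n => σ (s i)) {u | ∀ k, |centredSum s x n k u| < n * δ} +
      (Measure.pi fun i : Fin n => σ (s i)) {u | ∀ k, |centredSum s x n k u| < n * δ}ᶜ <
      1 / 2 + 1 / 2 := ENNReal.add_lt_add_of_lt_of_le (by simp) hc hbad
  rw [hadd, ENNReal.add_halves] at this
  exact lt_irrefl _ this

/-- Grouped by sample point, the linear part of the exponent is a combination of centred sums, at
most `n η` on `A`; the other `n η` comes from the individual densities. -/
lemma pi_tilted_le [Fintype Y] {ν : Measure ℝ} [IsProbabilityMeasure ν] {f : Y → ℝ → ℝ≥0∞}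
    (hf : ∀ k, Measurable (f k)) [∀ k, IsProbabilityMeasure (ν.withDensity (f k))]
    {t x a : Y → ℝ} {η : ℝ}
    (hle : ∀ k w, f k w ≤ ENNReal.ofReal (Real.exp (t k * (w - x k) + a k + η)))
    (s : ℕ → Y) {n : ℕ} (hn : n ≠ 0) {δ : ℝ} (hδ : (∑ k, |t k|) * δ ≤ η)
    {A : Set (Fin n → ℝ)} (hA : MeasurableSet A)
    (hAle : ∀ u ∈ A, ∀ k, |centredSum s x n k u| < n * δ) :
    (Measure.pi fun i : Fin n => ν.withDensity (f (s i))) A ≤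
      ENNReal.ofReal (Real.exp (n * (∑ k, empirical s n k * a k + 2 * η))) *
        (Measure.pi fun _ : Fin n => ν) A := by
  rw [pi_withDensity_eq (g := fun i : Fin n => f (s i)) (fun i => hf (s i)), withDensity_apply _ hA]
  refine (setLIntegral_mono measurable_const fun u hu => ?_).trans (by rw [setLIntegral_const])
  calc ∏ i : Fin n, f (s i) (u i)
      ≤ ∏ i : Fin n, ENNReal.ofReal (Real.exp (t (s i) * (u i - x (s i)) + a (s i) + η)) :=
        Finset.prod_le_prod' fun i _ => hle _ _
    _ = ENNReal.ofReal (Real.exp (∑ i : Fin n, (t (s i) * (u i - x (s i)) + a (s i) + η))) := by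
        rw [Real.exp_sum, ENNReal.ofReal_prod_of_nonneg fun _ _ => (Real.exp_pos _).le]
    _ ≤ _ := by
        refine ENNReal.ofReal_le_ofReal (Real.exp_le_exp.2 ?_)
        rw [Finset.sum_add_distrib, Finset.sum_add_distrib, ← sum_mul_centredSum,
          Fin.sum_univ_eq_sum_range (fun i => a (s i)), ← sum_mul_empirical a s hn]
        have h1 : ∑ k, t k * centredSum s x n k u ≤ n * η := by
          calc ∑ k, t k * centredSum s x n k u ≤ ∑ k, |t k| * (n * δ) := by
                refine Finset.sum_le_sum fun k _ => (le_abs_self _).trans ?_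
                rw [abs_mul]
                exact mul_le_mul_of_nonneg_left (hAle u hu k).le (abs_nonneg _)
            _ = n * ((∑ k, |t k|) * δ) := by rw [← Finset.sum_mul]; ring
            _ ≤ n * η := by gcongr
        simp only [Finset.sum_const, Finset.card_univ, Fintype.card_fin, nsmul_eq_mul]
        linarith

variable {Ω : Type*} [MeasurableSpace Ω] {μ : Measure Ω} [Fintype Y]

/-- The large deviation lower bound at interior points. -/
lemma eventually_le_measure_blockMean {ν : Measure ℝ} [IsProbabilityMeasure ν] {W : ℕ → Ω → ℝ}
    (hWm : ∀ i, Measurable (W i)) (hWi : iIndepFun W μ) (hWlaw : ∀ i, μ.map (W i) = ν) {P : Y → ℝ}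
    (hP : ∀ k, 0 < P k) {s : ℕ → Y}
    (hs : ∀ k, Tendsto (fun n => empirical s n k) atTop (𝓝 (P k))) {v : Y → ℝ} {c : ℝ}
    (hv : divW ν v P < c)
    (hvi : ∀ (s : ℝ), s ≠ 0 → ∀ k, ν {w | 0 < s * (w - v k / P k)} ≠ 0)
    {U : Set (Y → ℝ)} (hU : U ∈ 𝓝 v) :
    ∀ᶠ n : ℕ in atTop, ENNReal.ofReal (Real.exp (-(n * c))) ≤
      μ {ω | blockMean s n (fun i => W i ω) ∈ U} := by
  have := hWi.isProbabilityMeasure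
  obtain ⟨a, ha, hsum⟩ := exists_of_divW_lt_top hP (hv.trans (EReal.coe_lt_top c))
  rw [hsum] at hv
  have hv : ∑ k, P k * a k < c := by exact_mod_cast hv
  -- Two shares of `η` pay for the change of measure, one for the empirical frequencies, one for the
  -- factor `1 / 2`.
  set η := (c - ∑ k, P k * a k) / 4 with hη
  have hη0 : 0 < η := by rw [hη]; linarith
  choose f t hfm hfp hL hmean hle using fun k =>
    exists_tilt (ha k).le (hvi 1 one_ne_zero k) (hvi (-1) (by norm_num) k) hη0
  obtain ⟨ρ, hρ, hball⟩ := Metric.mem_nhds_iff.1 hU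
  set T := ∑ k, |t k| with hT
  have hT0 : 0 ≤ T := Finset.sum_nonneg fun k _ => abs_nonneg _
  set δ := min (ρ / 2) (η / (T + 1)) with hδ
  have hδ0 : 0 < δ := lt_min (by positivity) (by positivity)
  have hδη : T * δ ≤ η := by
    have h1 : (T + 1) * δ ≤ η := by
      rw [← le_div_iff₀' (by positivity)]; exact min_le_right _ _
    nlinarith
  have e1 := eventually_half_le_pi hL hmean s hδ0
  have e2 : ∀ᶠ n in atTop, ∀ k, |empirical s n k * (v k / P k) - v k| < ρ / 2 :=
    eventually_all.2 fun k => by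
      have h1 := (((hs k).mul_const (v k / P k)).sub_const (v k)).abs
      rw [mul_div_cancel₀ _ (hP k).ne', sub_self, abs_zero] at h1
      exact h1.eventually_lt_const (by positivity)
  have e3 : ∀ᶠ n in atTop, ∑ k, empirical s n k * a k < ∑ k, P k * a k + η := by
    have h1 : Tendsto (fun n => ∑ k, empirical s n k * a k) atTop (𝓝 (∑ k, P k * a k)) :=
      tendsto_finsetSum _ fun k _ => (hs k).mul_const _
    exact h1.eventually_lt_const (by linarith)
  filter_upwards [e1, e2, e3, eventually_two_mul_exp_le (by linarith : c - η < c),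
    eventually_ne_atTop 0] with n h1 h2 h3 h4 hn0
  have hn' : (0 : ℝ) < n := by positivity
  set A := {u : Fin n → ℝ | ∀ k, |centredSum s (fun k => v k / P k) n k u| < n * δ} with hAdef
  have hm : MeasurableSet A := by
    simp only [hAdef, Set.ofPred_forall]
    exact MeasurableSet.iInter fun k =>
      measurableSet_lt (measurable_centredSum s _ n k).abs measurable_const
  have h5 := h1.trans (pi_tilted_le hfm hle s hn0 hδη hm fun u hu k => hu k)
  have hmap : μ.map (fun ω (i : Fin n) => W i ω) = Measure.pi fun _ : Fin n => ν := by
    have := (iIndepFun_iff_map_fun_eq_pi_map fun i : Fin n => (hWm i).aemeasurable).1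
      (hWi.precomp Fin.val_injective)
    simpa only [hWlaw] using this
  rw [← hmap, Measure.map_apply (by fun_prop) hm] at h5
  have hsub : (fun ω (i : Fin n) => W i ω) ⁻¹' A ⊆
      {ω | blockMean s n (fun i => W i ω) ∈ U} := by
    intro ω hω
    refine hball ?_
    rw [Metric.mem_ball, dist_pi_lt_iff hρ]
    intro k
    have h6 := hω k
    rw [centredSum_eq s _ hn0 k fun i => W i ω, abs_mul, abs_of_pos hn', mul_lt_mul_iff_right₀ hn']
      at h6
    rw [Real.dist_eq]
    have h7 : blockMean s n (fun i => W i ω) k - v k =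
      (blockMean s n (fun i => W i ω) k - empirical s n k * (v k / P k)) +
        (empirical s n k * (v k / P k) - v k) := by ring
    rw [h7]
    refine (abs_add_le _ _).trans_lt ?_
    linarith [h2 k, min_le_left (ρ / 2) (η / (T + 1))]
  set p := μ {ω | blockMean s n (fun i => W i ω) ∈ U} with hp
  have h8 : (1 / 2 : ℝ≥0∞) ≤ ENNReal.ofReal (Real.exp (n * (c - η))) * p := by
    refine h5.trans (mul_le_mul' (ENNReal.ofReal_le_ofReal (Real.exp_le_exp.2 ?_))
      (measure_mono hsub))
    exact mul_le_mul_of_nonneg_left (by linarith) hn'.le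
  have h9 : 2 * ENNReal.ofReal (Real.exp (-(n * c))) ≤
      ENNReal.ofReal (Real.exp (-(n * (c - η)))) := by
    rw [← ENNReal.ofReal_ofNat, ← ENNReal.ofReal_mul (by norm_num)]
    exact ENNReal.ofReal_le_ofReal h4
  calc ENNReal.ofReal (Real.exp (-(n * c)))
      = 1 / 2 * (2 * ENNReal.ofReal (Real.exp (-(n * c)))) := by
        rw [← mul_assoc, one_div, ENNReal.inv_mul_cancel (by norm_num) (by norm_num), one_mul]
    _ ≤ ENNReal.ofReal (Real.exp (n * (c - η))) * p *
        ENNReal.ofReal (Real.exp (-(n * (c - η)))) := mul_le_mul' h8 h9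
    _ = p := by
        rw [mul_right_comm, ← ENNReal.ofReal_mul (Real.exp_pos _).le, ← Real.exp_add,
          add_neg_cancel, Real.exp_zero, ENNReal.ofReal_one, one_mul]

/-- The lower bound for the cone over a neighbourhood. -/
lemma eventually_le_measure_coneOver {ν : Measure ℝ} (hν : IsWeightLaw ν) {W : ℕ → Ω → ℝ}
    (hWm : ∀ i, Measurable (W i)) (hWi : iIndepFun W μ) (hWlaw : ∀ i, μ.map (W i) = ν)
    {P R : Y → ℝ} (hP : ∀ k, 0 < P k) (hP1 : P ∈ stdSimplex ℝ Y) {x s : ℕ → Y}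
    (hx : ∀ k, Tendsto (fun n => empirical x n k) atTop (𝓝 (R k)))
    (hs : ∀ k, Tendsto (fun n => empirical s n k) atTop (𝓝 (P k))) {ε r c : ℝ}
    (hr : r < ε) (hc : coneDivW ν (nbhd r R) P < c) :
    ∀ᶠ n : ℕ in atTop, ENNReal.ofReal (Real.exp (-(n * c))) ≤
      μ {ω | blockMean s n (fun i => W i ω) ∈ coneOver ε (empirical x n)} := by
  have := hν.isProbabilityMeasure
  obtain ⟨m, hm, Q, hQ, hlt⟩ := coneDivW_lt_iff.1 hc
  -- The gap from `r` to `ε'` makes room for an open set, the gap from `ε'` to `ε` for the error of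
  -- the empirical measure.
  obtain ⟨ε', hrε, hεε⟩ := exists_between hr
  obtain ⟨v, hv, hvi, hv0, hvc⟩ := exists_interior_point hν hP hP1 hrε hQ hm hlt
  have hU : ∀ᶠ b : Y → ℝ in 𝓝 v, ∑ j, b j ≠ 0 ∧
      ∀ k, 0 < b k / ∑ j, b j ∧ |b k / ∑ j, b j - R k| < ε' := by
    have hcont : ∀ k, ContinuousAt (fun b : Y → ℝ => b k / ∑ j, b j) v := fun k =>
      ContinuousAt.div (continuous_apply k).continuousAt (by fun_prop) hv0
    have hsum : ContinuousAt (fun b : Y → ℝ => ∑ j, b j) v := by fun_prop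
    refine (hsum.eventually_ne hv0).and (eventually_all.2 fun k => ?_)
    exact ((hcont k).eventually_const_lt (hvc k).1).and
      (((hcont k).sub continuousAt_const).abs.eventually_lt_const (hvc k).2)
  have hclose : ∀ᶠ n in atTop, ∀ k, |empirical x n k - R k| < ε - ε' := eventually_all.2 fun k => by
    refine Tendsto.eventually_lt_const (sub_pos.2 hεε) ?_
    simpa using ((hx k).sub_const (R k)).abs
  filter_upwards [eventually_le_measure_blockMean hWm hWi hWlaw hP hs hv hvi hU, hclose]
    with n hn hcl
  refine hn.trans (measure_mono fun ω hω => ?_)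
  obtain ⟨h0, h1⟩ := hω
  refine ⟨h0, ⟨fun k => (h1 k).1.le, by rw [← Finset.sum_div, div_self h0]⟩, fun k => ?_⟩
  refine (abs_sub_le _ (R k) _).trans ?_
  rw [abs_sub_comm (R k)]
  linarith [(h1 k).2, hcl k]

end LowerBound

/-! ### Sampling and conditioning. -/

lemma measurableSet_coneOver {Y : Type*} [Fintype Y] (r : ℝ) (R : Y → ℝ) : MeasurableSet (coneOver r R) := by
  have hn : MeasurableSet (nbhd r R) := by
    simp only [nbhd, Set.ofPred_and, Set.ofPred_forall]
    exact (isClosed_stdSimplex ℝ Y).measurableSet.inter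
      (MeasurableSet.iInter fun k => measurableSet_le (by fun_prop) (by fun_prop))
  have h0 : MeasurableSet {b : Y → ℝ | ∑ k, b k = 0} :=
    measurableSet_eq_fun (by fun_prop) (by fun_prop)
  have hm : Measurable fun (b : Y → ℝ) k => b k / ∑ j, b j :=
    measurable_pi_lambda _ fun k => by fun_prop
  exact h0.compl.inter (hm hn)

/-- The samples of size `n` take finitely many values, so the union of the null fibres is null. -/
lemma ae_measure_sampleEvent_ne_zero {Y Ω : Type*} [Fintype Y] [MeasurableSpace Ω] {μ : Measure Ω}
    {X S : ℕ → Ω → Y} :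
    ∀ᵐ ω ∂μ, ∀ n, μ (sampleEvent X S n ω) ≠ 0 := by
  refine ae_all_iff.2 fun n => ?_
  let T : Ω → Fin n → Y × Y := fun ω i => (S i ω, X i ω)
  have hT : ∀ ω, sampleEvent X S n ω = T ⁻¹' {T ω} := fun ω => by
    ext ω'
    simp only [sampleEvent, Set.mem_ofPred_eq, Set.mem_preimage, Set.mem_singleton_iff, T,
      funext_iff, Prod.mk.injEq]
    exact ⟨fun h i => h i i.2, fun h i hi => h ⟨i, hi⟩⟩
  have hnull : μ (⋃ z : {z // μ (T ⁻¹' {z}) = 0}, T ⁻¹' {z.1}) = 0 :=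
    measure_iUnion_null fun z => z.2
  rw [ae_iff]
  refine measure_mono_null (fun ω hω => ?_) hnull
  rw [Set.mem_ofPred_eq, not_not, hT] at hω
  exact Set.mem_iUnion.2 ⟨⟨T ω, hω⟩, rfl⟩

section Sampling

variable {Y Ω : Type*} [Fintype Y] [MeasurableSpace Y] [MeasurableSingletonClass Y]
  [MeasurableSpace Ω] {μ : Measure Ω} [IsProbabilityMeasure μ]

lemma ae_tendsto_empirical {X : ℕ → Ω → Y} (hXm : ∀ i, Measurable (X i)) (hXi : iIndepFun X μ)
    {p : Y → ℝ} (hXlaw : ∀ i k, μ.real (X i ⁻¹' {k}) = p k) :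
    ∀ᵐ ω ∂μ, ∀ k, Tendsto (fun n => empirical (fun i => X i ω) n k) atTop (𝓝 (p k)) := by
  refine ae_all_iff.2 fun k => ?_
  have hg : Measurable fun y : Y => diracAt y k := measurable_of_finite _
  have hident : ∀ i, IdentDistrib (X i) (X 0) μ μ := fun i => by
    refine ⟨(hXm i).aemeasurable, (hXm 0).aemeasurable, ?_⟩
    refine Measure.ext_of_singleton fun y => ?_
    rw [Measure.map_apply (hXm i) (measurableSet_singleton y),
      Measure.map_apply (hXm 0) (measurableSet_singleton y),
      ← measureReal_eq_measureReal_iff, hXlaw, hXlaw]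
  have hind : (fun ω => diracAt (X 0 ω) k) = (X 0 ⁻¹' {k}).indicator fun _ => (1 : ℝ) := by
    ext ω
    by_cases h : k = X 0 ω
    · rw [← h, diracAt_of_eq, Set.indicator_of_mem (by simp [← h])]
    · rw [diracAt_of_ne h, Set.indicator_of_notMem (by simpa using Ne.symm h)]
  have hm0 : MeasurableSet (X 0 ⁻¹' {k}) := hXm 0 (measurableSet_singleton k)
  have hslln := strong_law_ae_real (μ := μ) (fun i ω => diracAt (X i ω) k)
    (by simp only [hind]; exact (integrable_const 1).indicator hm0)
    (fun i j hij => (hXi.indepFun hij).comp hg hg)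
    (fun i => (hident i).comp hg)
  have hmean : ∫ ω, diracAt (X 0 ω) k ∂μ = p k := by
    rw [hind, integral_indicator_const _ hm0, hXlaw]
    simp
  rw [hmean] at hslln
  filter_upwards [hslln] with ω hω
  refine hω.congr fun n => ?_
  rw [empirical]
  ring

variable {X S : ℕ → Ω → Y}

/-- By independence, conditioning on the samples freezes them. -/
lemma cond_closeEvent (hXm : ∀ i, Measurable (X i)) (hSm : ∀ i, Measurable (S i)) {W : ℕ → Ω → ℝ}
    (hWind : IndepFun (fun ω i => W i ω) (fun ω i => (X i ω, S i ω)) μ) (ε : ℝ) {n : ℕ}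
    (hn : n ≠ 0) {ω : Ω} (hω : μ (sampleEvent X S n ω) ≠ 0) :
    ProbabilityTheory.cond μ (sampleEvent X S n ω) (closeEvent X S W ε n) =
      μ {ω' | blockMean (fun i => S i ω) n (fun i => W i ω') ∈
        coneOver ε (empirical (fun i => X i ω) n)} := by
  have hsm : MeasurableSet (sampleEvent X S n ω) := by
    simp only [sampleEvent, Set.ofPred_forall, Set.ofPred_and]
    exact MeasurableSet.iInter fun i => MeasurableSet.iInter fun _ =>
      (hSm i (measurableSet_singleton _)).inter (hXm i (measurableSet_singleton _))
  let B : Set (ℕ → ℝ) := {w | blockMean (fun i => S i ω) n w ∈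
    coneOver ε (empirical (fun i => X i ω) n)}
  let C : Set (ℕ → Y × Y) := {z | ∀ i < n, (z i).2 = S i ω ∧ (z i).1 = X i ω}
  have hB : MeasurableSet B := by
    have hm : Measurable (blockMean (fun i => S i ω) n) :=
      measurable_pi_lambda _ fun k => by unfold blockMean; fun_prop
    exact hm (measurableSet_coneOver _ _)
  have hC : MeasurableSet C := by
    simp only [C, Set.ofPred_forall, Set.ofPred_and]
    have h1 : ∀ i, Measurable fun z : ℕ → Y × Y => (z i).1 := fun i => by fun_prop
    have h2 : ∀ i, Measurable fun z : ℕ → Y × Y => (z i).2 := fun i => by fun_prop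
    exact MeasurableSet.iInter fun i => MeasurableSet.iInter fun _ =>
      (h2 i (measurableSet_singleton _)).inter (h1 i (measurableSet_singleton _))
  have hset : sampleEvent X S n ω ∩ closeEvent X S W ε n =
      (fun ω i => W i ω) ⁻¹' B ∩ (fun ω i => (X i ω, S i ω)) ⁻¹' C := by
    ext ω'
    -- On the sample event, the close event is an event of the weights alone, so independence
    -- applies.
    have key : ω' ∈ sampleEvent X S n ω →
        (ω' ∈ closeEvent X S W ε n ↔ (fun i => W i ω') ∈ B) := fun h => by
      have h1 : empirical (fun i => X i ω') n = empirical (fun i => X i ω) n := by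
        ext k
        simp only [empirical]
        congr 1
        exact Finset.sum_congr rfl fun i hi => by rw [(h i (Finset.mem_range.1 hi)).2]
      have h2 : blockMean (fun i => S i ω') n (fun i => W i ω') =
          blockMean (fun i => S i ω) n (fun i => W i ω') := by
        ext k
        simp only [blockMean]
        congr 1
        exact Finset.sum_congr rfl fun i hi => by rw [(h i (Finset.mem_range.1 hi)).1]
      refine (exists_normWeighted_iff _ _ hn _).trans ?_
      rw [h1, h2]
      rfl
    constructor
    · rintro ⟨h1, h2⟩
      exact ⟨(key h1).1 h2, h1⟩
    · rintro ⟨h1, h2⟩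
      exact ⟨h2, (key h2).2 h1⟩
  have hind := hWind.measure_inter_preimage_eq_mul _ _ hB hC
  rw [cond_apply hsm, hset, hind, mul_comm (μ _) (μ _), ← mul_assoc]
  have hCs : (fun ω i => (X i ω, S i ω)) ⁻¹' C = sampleEvent X S n ω := rfl
  rw [hCs, ENNReal.inv_mul_cancel hω (measure_ne_top _ _), one_mul]
  rfl

end Sampling

/-! ### From probabilities to rates, and existence of the limit. -/

section Rate

lemma one_div_mul_log_le {n : ℕ} (hn : n ≠ 0) {p : ℝ≥0∞} {a : ℝ}
    (h : p ≤ ENNReal.ofReal (Real.exp (-(n * a)))) :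
    ((1 / (n : ℝ) : ℝ) : EReal) * ENNReal.log p ≤ ((-a : ℝ) : EReal) := by
  have hn' : (0 : ℝ) < n := by positivity
  have h1 := ENNReal.log_monotone h
  rw [ENNReal.log_ofReal_of_pos (Real.exp_pos _), Real.log_exp] at h1
  refine (mul_le_mul_of_nonneg_left h1 (by exact_mod_cast (by positivity : 0 ≤ 1 / (n : ℝ)))).trans
    (le_of_eq ?_)
  rw [← EReal.coe_mul]
  congr 1
  field_simp

lemma le_one_div_mul_log {n : ℕ} (hn : n ≠ 0) {p : ℝ≥0∞} {a : ℝ}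
    (h : ENNReal.ofReal (Real.exp (-(n * a))) ≤ p) :
    ((-a : ℝ) : EReal) ≤ ((1 / (n : ℝ) : ℝ) : EReal) * ENNReal.log p := by
  have hn' : (0 : ℝ) < n := by positivity
  have h1 := ENNReal.log_monotone h
  rw [ENNReal.log_ofReal_of_pos (Real.exp_pos _), Real.log_exp] at h1
  refine (le_of_eq ?_).trans
    (mul_le_mul_of_nonneg_left h1 (by exact_mod_cast (by positivity : 0 ≤ 1 / (n : ℝ))))
  rw [← EReal.coe_mul]
  congr 1
  field_simp

lemma neg_le_liminf_of_forall {L : ℕ → EReal} {J : EReal}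
    (h : ∀ c : ℝ, J < c → ∀ᶠ n in atTop, ((-c : ℝ) : EReal) ≤ L n) : -J ≤ liminf L atTop := by
  rw [EReal.neg_le]
  refine EReal.le_of_forall_lt_iff_le.1 fun z hz => ?_
  rw [EReal.neg_le, ← EReal.coe_neg]
  exact le_liminf_of_le (by isBoundedDefault) (h z hz)

lemma limsup_le_neg_of_forall {L : ℕ → EReal} {J : EReal}
    (h : ∀ c : ℝ, (c : EReal) < J → ∀ᶠ n in atTop, L n ≤ ((-c : ℝ) : EReal)) :
    limsup L atTop ≤ -J := by
  rw [EReal.le_neg]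
  refine EReal.ge_of_forall_gt_iff_ge.1 fun z hz => ?_
  rw [EReal.le_neg, ← EReal.coe_neg]
  exact limsup_le_of_le (by isBoundedDefault) (h z hz)

variable {Y : Type*} [Fintype Y] {ν : Measure ℝ} {P R : Y → ℝ}

lemma coneDivW_lt_top_of_criticalRadius_lt (hν : IsWeightLaw ν) (hP : ∀ k, 0 < P k)
    (hP1 : P ∈ stdSimplex ℝ Y) (hR : R ∈ stdSimplex ℝ Y) {ε : ℝ}
    (h : criticalRadius ν R P < ε) : ∃ r < ε, coneDivW ν (nbhd r R) P < ⊤ := by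
  have hle : ∀ Q ∈ stdSimplex ℝ Y, ∀ k, Q k ≤ 1 := fun Q hQ k =>
    hQ.2 ▸ Finset.single_le_sum (fun k _ => hQ.1 k) (Finset.mem_univ k)
  have hmem : P ∈ nbhd 1 R := ⟨hP1, fun k => abs_le.2
    ⟨by linarith [hP1.1 k, hle R hR k], by linarith [hR.1 k, hle P hP1 k]⟩⟩
  have hone : coneDivW ν (nbhd 1 R) P < ⊤ := by
    refine (coneDivW_le ν P hmem one_ne_zero).trans_lt ?_
    rw [one_smul, divW_self hν hP]
    exact EReal.zero_lt_top
  obtain ⟨r, hr, hlt⟩ := exists_lt_of_csInf_lt ⟨1, hone⟩ h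
  exact ⟨r, hlt, hr⟩

lemma coneDivW_eq_top_of_lt_criticalRadius {r : ℝ} (h : r < criticalRadius ν R P) :
    coneDivW ν (nbhd r R) P = ⊤ := by
  by_contra hc
  -- Negative radii give empty neighbourhoods and infinite rate, so the set of radii is bounded
  -- below.
  refine notMem_of_lt_csInf h ⟨0, fun r' hr' => ?_⟩ (lt_top_iff_ne_top.2 hc)
  obtain ⟨m, -, Q, hQ, -⟩ := coneDivW_lt_iff.1 (show coneDivW ν (nbhd r' R) P < ⊤ from hr')
  exact radius_nonneg_of_mem_nbhd hQ

/-- Away from the critical radius the two bounds leave no gap. -/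
lemma exists_tendsto_of_bounds (hν : IsWeightLaw ν) (hP : ∀ k, 0 < P k)
    (hP1 : P ∈ stdSimplex ℝ Y) (hR : R ∈ stdSimplex ℝ Y) {ε : ℝ} (hε : 0 < ε)
    (hcrit : ε ≠ criticalRadius ν R P) {L : ℕ → EReal}
    (hlow : ∀ α < 1, -coneDivW ν (nbhd (α * ε) R) P ≤ liminf L atTop)
    (hup : ∀ β > 1, limsup L atTop ≤ -coneDivW ν (nbhd (β * ε) R) P) :
    ∃ l, Tendsto L atTop (𝓝 l) := by
  refine ⟨liminf L atTop, tendsto_of_le_liminf_of_limsup_le le_rfl ?_⟩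
  rcases lt_or_gt_of_ne hcrit with h | h
  · obtain ⟨r, hr1, hr2⟩ := exists_between h
    have h1 := hup (r / ε) ((one_lt_div hε).2 hr1)
    rw [div_mul_cancel₀ _ hε.ne', coneDivW_eq_top_of_lt_criticalRadius hr2, EReal.neg_top] at h1
    exact h1.trans bot_le
  · obtain ⟨r, hr, hfin⟩ := coneDivW_lt_top_of_criticalRadius_lt hν hP hP1 hR h
    by_contra hc
    rw [not_le] at hc
    obtain ⟨c', h1, h2⟩ := EReal.exists_between_coe_real hc
    obtain ⟨c, h3, h4⟩ := EReal.exists_between_coe_real h2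
    -- With `liminf < c' < c < limsup`, the upper bound makes the rate at most `-c` for all `β > 1`;
    -- then it is at most `-c'` for some `α < 1`, and the lower bound gives `c' ≤ liminf`.
    obtain ⟨α, hα, hle⟩ := exists_coneDivW_le_of_forall_le hν hP hP1 hR hε hr hfin
      (neg_lt_neg (by exact_mod_cast h3 : c' < c)) fun β hβ => by
        rw [EReal.coe_neg, EReal.le_neg]
        exact h4.le.trans (hup β hβ)
    have h5 := hlow α hα
    rw [EReal.coe_neg, EReal.le_neg] at hle
    exact absurd (h1.trans_le (hle.trans h5)) (lt_irrefl _)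

end Rate

end WeightedBootstrap

open WeightedBootstrap in
theorem mainTheorem1
    {Y Ω Θ : Type*} [Fintype Y] [MeasurableSpace Y] [MeasurableSingletonClass Y]
    [MeasurableSpace Ω] (μ : Measure Ω) [IsProbabilityMeasure μ]
    -- the model: probability vectors with positive entries
    (P : Θ → Y → ℝ) (hP : ∀ θ, P θ ∈ stdSimplex ℝ Y) (hPpos : ∀ θ k, 0 < P θ k)
    (θT θ : Θ)
    -- the observed sample, iid under the true parameter
    (X : ℕ → Ω → Y) (hXm : ∀ i, Measurable (X i)) (hXi : iIndepFun X μ)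
    (hXlaw : ∀ i k, μ.real (X i ⁻¹' {k}) = P θT k)
    -- the simulated sample, iid under the fixed parameter
    (S : ℕ → Ω → Y) (hSm : ∀ i, Measurable (S i)) (hSi : iIndepFun S μ)
    (hSlaw : ∀ i k, μ.real (S i ⁻¹' {k}) = P θ k)
    -- the weights, iid and independent of the samples
    (ν : Measure ℝ) (hν : IsWeightLaw ν)
    (W : ℕ → Ω → ℝ) (hWm : ∀ i, Measurable (W i)) (hWi : iIndepFun W μ)
    (hWlaw : ∀ i, μ.map (W i) = ν)
    (hWind : IndepFun (fun ω i => W i ω) (fun ω i => (X i ω, S i ω)) μ)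
    (ε : ℝ) (hε : 0 < ε) :
    ∀ᵐ ω ∂μ,
      (∀ α β : ℝ, α < 1 → 1 < β →
        -coneDivW ν (nbhd (α * ε) (P θT)) (P θ) ≤
            liminf (fun n : ℕ => logCondProb μ X S W ε n ω) atTop ∧
          limsup (fun n : ℕ => logCondProb μ X S W ε n ω) atTop ≤
            -coneDivW ν (nbhd (β * ε) (P θT)) (P θ)) ∧
      (ε ≠ criticalRadius ν (P θT) (P θ) →
        ∃ l : EReal, Tendsto (fun n : ℕ => logCondProb μ X S W ε n ω) atTop (𝓝 l) ∧
          ∀ α β : ℝ, α < 1 → 1 < β →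
            -coneDivW ν (nbhd (α * ε) (P θT)) (P θ) ≤ l ∧
              l ≤ -coneDivW ν (nbhd (β * ε) (P θT)) (P θ)) := by
  have hS := ae_tendsto_empirical hSm hSi hSlaw
  have hX := ae_tendsto_empirical hXm hXi hXlaw
  -- The exceptional null set depends on the samples only, so it serves all `α` and `β` at once.
  filter_upwards [hS, hX, ae_measure_sampleEvent_ne_zero (μ := μ) (X := X) (S := S)]
    with ω hs hx hpos
  have hL : ∀ n ≠ 0, logCondProb μ X S W ε n ω = ((1 / (n : ℝ) : ℝ) : EReal) *
      ENNReal.log (μ {ω' | blockMean (fun i => S i ω) n (fun i => W i ω') ∈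
        coneOver ε (empirical (fun i => X i ω) n)}) := fun n hn => by
    rw [logCondProb, cond_closeEvent hXm hSm hWind ε hn (hpos n)]
  have hlow : ∀ α < 1, -coneDivW ν (nbhd (α * ε) (P θT)) (P θ) ≤
      liminf (fun n : ℕ => logCondProb μ X S W ε n ω) atTop := fun α hα =>
    neg_le_liminf_of_forall fun c hc => by
      filter_upwards [eventually_le_measure_coneOver hν hWm hWi hWlaw (hPpos θ) (hP θ) hx hs
        (by nlinarith : α * ε < ε) hc, eventually_ne_atTop 0] with n hn hn0
      rw [hL n hn0]
      exact le_one_div_mul_log hn0 hn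
  have hup : ∀ β > 1, limsup (fun n : ℕ => logCondProb μ X S W ε n ω) atTop ≤
      -coneDivW ν (nbhd (β * ε) (P θT)) (P θ) := fun β hβ =>
    limsup_le_neg_of_forall fun c hc => by
      filter_upwards [eventually_measure_coneOver_le hν hWm hWi hWlaw (hPpos θ) (hP θ) (hP θT) hx hs
        hε (by nlinarith : ε < β * ε) hc, eventually_ne_atTop 0] with n hn hn0
      rw [hL n hn0]
      exact one_div_mul_log_le hn0 hn
  refine ⟨fun α β hα hβ => ⟨hlow α hα, hup β hβ⟩, fun hcrit => ?_⟩
  obtain ⟨l, hl⟩ := exists_tendsto_of_bounds hν (hPpos θ) (hP θ) (hP θT) hε hcrit hlow hup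
  refine ⟨l, hl, fun α β hα hβ => ⟨?_, ?_⟩⟩
  · rw [← hl.liminf_eq]
    exact hlow α hα
  · rw [← hl.limsup_eq]
    exact hup β hβ
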